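/- **Setting.** Let $\Lambda$ be a finite connected graph with graph distance $d_{i,j}$, let $D\ge 1$ be an integer, and let $\gamma\ge 1$ be a lattice constant: $|\{j: d_{i,j}\le s\}|\le\gamma s^{D}$ and $|\{j:d_{i,j}=s\}|\le \gamma s^{D-1}$ for all $i\in\Lambda$ and all integers $s\ge1$. For $X\subseteq\Lambda$ put $X[r]=\{i: d_{i,X}\le r\}$, let $\partial X$ be the set of sites of $X$ with a neighbour outside $X$, and let $(\partial X)_s=\{i\in X: d_{i,\partial X}=|s|\}$ for integers $s\le 0$ and $(\partial X)_s=\{i\in X^{c}: d_{i,\partial X}=s\}$ for $s>0$. A spin $1/2$ sits at each site. The Hamiltonian is $H=\sum_{|Z|\le k}h_Z$, $h_Z=\sum_q J_{Z,q}P_{Z,q}$, where $P_{Z,q}$ ($1\le q\le 3^{|Z|}$) are the products of Pauli matrices $\sigma^x,\sigma^y,\sigma^z$ with support exactly $Z$ and $J_{Z,q}\in\mathbb R$. Let $\alpha>D$ and $J_0>0$ be such that $$\sum_{Z\supseteq\{i,i'\}}\|h_Z\|\le J_0(d_{i,i'}+1)^{-\alpha}\qquad\text{for all } i,i'\in\Lambda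 .$$ Let $g$ and $\lambda$ be any constants with $\sum_{(Z,q):Z\ni i}|J_{Z,q}|\le g$ for all $i$ and $\sum_{j\in\Lambda}(d_{i,j}+1)^{-\alpha}(d_{j,i'}+1)^{-\alpha}\le\lambda(d_{i,i'}+1)^{-\alpha}$ for all $i,i'$. Put $J=3^{k/2}J_0$, $\tilde g=\max(gk,\lambda J)$ and $$C_0=\frac{2^{\alpha-D/2+2}J_0\gamma}{2\alpha-D-1}+\frac{80\,\tilde g\,\gamma\,2^{\alpha-D/2}}{\alpha-D}\sqrt{2\alpha-2D+\gamma}.$$ Write $\|\cdot\|$ for the operator norm, $\|A\|_F=\sqrt{\mathrm{tr}(A^\dagger A)/\mathrm{tr}(1)}$, $W(t)=e^{iHt}We^{-iHt}$, and $W(t,\tilde X)=\frac{1}{\mathrm{tr}_{\tilde X^c}(1)}\mathrm{tr}_{\tilde X^c}[W(t)]\otimes 1_{\tilde X^c}$. **Theorem.** Let $X\subseteq\Lambda$, let $r\ge1$ be an integer, and assume that at least one of the following holds: (a) $\Lambda$ is a lattice region: it is a geodesically convex induced subgraph of a finite connected graph (possibly all of it) whose automorphism group is transitive on the vertices and for which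 $\gamma$ is also a lattice constant in dimension $D$ (for example a lattice with periodic boundary conditions, or a box in such a lattice); here $X$ is arbitrary; (b) $|(\partial X)_l|\le|(\partial X)_{\lfloor r/2\rfloor}|$ for all integers $l\le\lfloor r/2\rfloor$; here $\Lambda$ is arbitrary. Then for every operator $W_X$ acting on the spins in $X$ with $\|W_X\|=1$ and every real $t$ with $|t|\le 1/(2e\tilde g)$, $$\|W_X(t)-W_X(t,X[r])\|_F\le C_0|t|\sqrt{\gamma^{-1}\,|(\partial X)_{\lfloor r/2\rfloor}|\,r^{-2\alpha+D+1}} .$$ -/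

import Mathlib

noncomputable section

namespace LongRange

open scoped Classical in
/-- `i[s]`: the sites at graph distance at most `s` from the site `i`. -/
def ball {V : Type*} [Fintype V] (G : SimpleGraph V) (i : V) (s : ℕ) : Finset V :=
  Finset.univ.filter fun j => G.dist i j ≤ s

open scoped Classical in
/-- The sites at graph distance exactly `s` from the site `i`. -/
def sphere {V : Type*} [Fintype V] (G : SimpleGraph V) (i : V) (s : ℕ) : Finset V :=
  Finset.univ.filter fun j => G.dist i j = s

/-- `γ` is a lattice constant of the graph in dimension `D`: volumes of balls and sizes of
spheres of radius `s ≥ 1` are at most `γ s ^ D` and `γ s ^ (D - 1)`. -/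
def IsLatticeConstant {V : Type*} [Fintype V] (G : SimpleGraph V) (D : ℕ) (γ : ℝ) : Prop :=
  ∀ (i : V) (s : ℕ), 1 ≤ s →
    ((ball G i s).card : ℝ) ≤ γ * (s : ℝ) ^ (D : ℝ) ∧
    ((sphere G i s).card : ℝ) ≤ γ * (s : ℝ) ^ ((D : ℝ) - 1)

/-- All sites are equivalent under automorphisms of the graph. -/
def IsHomogeneous {V : Type*} (G : SimpleGraph V) : Prop :=
  ∀ i j : V, ∃ φ : G ≃g G, φ i = j

/-- `G` is a geodesically convex region of a finite connected homogeneous lattice with lattice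
constant `γ` in dimension `D`; `G` may be the entire lattice (periodic boundary conditions), or
for instance a rectangular box inside a sufficiently large torus (open boundary conditions). -/
def IsLatticeRegion {V : Type*} (G : SimpleGraph V) (D : ℕ) (γ : ℝ) : Prop :=
  ∃ (N : ℕ) (L : SimpleGraph (Fin N)) (f : G ↪g L),
    L.Connected ∧ IsHomogeneous L ∧ IsLatticeConstant L D γ ∧
    ∀ (i j : V) (v : Fin N),
      L.dist (f i) v + L.dist v (f j) = L.dist (f i) (f j) → v ∈ Set.range f

section Geometry

variable {V : Type*} [Fintype V] [DecidableEq V]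

/-- The distance `d_{i,Y}` of a site to a set of sites (infinite if `Y` is empty). -/
def distTo (G : SimpleGraph V) (i : V) (Y : Finset V) : ℕ∞ :=
  ⨅ j ∈ Y, G.edist i j

open scoped Classical in
/-- `X[r]`: the sites at distance at most `r` from `X`. -/
def nbhd (G : SimpleGraph V) (X : Finset V) (r : ℕ) : Finset V :=
  Finset.univ.filter fun i => distTo G i X ≤ (r : ℕ∞)

open scoped Classical in
/-- The surface `∂X`: the sites of `X` that have a neighbour outside `X`. -/
def surface (G : SimpleGraph V) (X : Finset V) : Finset V :=
  X.filter fun i => ∃ j, j ∉ X ∧ G.Adj i j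

open scoped Classical in
/-- The shell `(∂X)_s`: the sites at distance `|s|` from `∂X`, inside `X` if `s ≤ 0` and
outside `X` if `s > 0`. -/
def shell (G : SimpleGraph V) (X : Finset V) (s : ℤ) : Finset V :=
  if s ≤ 0 then X.filter fun i => distTo G i (surface G X) = (s.natAbs : ℕ∞)
  else Xᶜ.filter fun i => distTo G i (surface G X) = (s.natAbs : ℕ∞)

end Geometry

section Operators

variable {V : Type*} [Fintype V] [DecidableEq V]

/-- Operators on the Hilbert space of spins `1/2` sitting at the points of `V`, as matrices in
the computational basis. -/
abbrev Op (V : Type*) : Type _ := Matrix (V → Fin 2) (V → Fin 2) ℂ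

/-- The operator norm. -/
def opNorm (A : Op V) : ℝ := ‖Matrix.toEuclideanCLM (𝕜 := ℂ) A‖

/-- The normalized Frobenius norm `√(tr (A† A) / tr 1)`. -/
def frobNorm (A : Op V) : ℝ :=
  Real.sqrt ((Matrix.trace (A.conjTranspose * A)).re / (Matrix.trace (1 : Op V)).re)

/-- The operator `w ⊗ 1` for an operator `w` of the spins in `X`. -/
def extend (X : Finset V) (w : Op {i // i ∈ X}) : Op V := fun σ τ =>
  if ∀ i, i ∉ X → σ i = τ i then w (fun i => σ i) (fun i => τ i) else 0

/-- `A` acts on the spins in `X` only. -/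
def ActsOn (X : Finset V) (A : Op V) : Prop := ∃ w : Op {i // i ∈ X}, A = extend X w

/-- The configuration equal to `a` on `X` and to `b` outside `X`. -/
def glue (X : Finset V) (a : {i // i ∈ X} → Fin 2) (b : {i // i ∉ X} → Fin 2) : V → Fin 2 :=
  fun i => if h : i ∈ X then a ⟨i, h⟩ else b ⟨i, h⟩

/-- The partial trace over the spins outside `X`. -/
def partialTrace (X : Finset V) (A : Op V) : Op {i // i ∈ X} := fun a a' =>
  ∑ b : {i // i ∉ X} → Fin 2, A (glue X a b) (glue X a' b)

/-- The normalized partial trace over the spins outside `X`, tensored with the identity there. -/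
def localApprox (X : Finset V) (A : Op V) : Op V :=
  (Matrix.trace (1 : Op {i // i ∉ X}))⁻¹ • extend X (partialTrace X A)

/-- The Heisenberg evolution `exp(iHt) W exp(-iHt)`. -/
def evolve (H : Op V) (t : ℝ) (W : Op V) : Op V :=
  NormedSpace.exp ((Complex.I * (t : ℂ)) • H) * W * NormedSpace.exp ((-(Complex.I * (t : ℂ))) • H)

/-- The identity and the three Pauli matrices. -/
def pauli : Fin 4 → Matrix (Fin 2) (Fin 2) ℂ :=
  ![1, !![0, 1; 1, 0], !![0, -Complex.I; Complex.I, 0], !![1, 0; 0, -1]]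

/-- The product over all sites `i` of the Pauli matrix with label `p i` at `i`. -/
def pauliString (p : V → Fin 4) : Op V := fun σ τ => ∏ i, pauli (p i) (σ i) (τ i)

/-- The sites on which a Pauli string is not the identity. -/
def supp (p : V → Fin 4) : Finset V := Finset.univ.filter fun i => p i ≠ 0

/-- The interaction term `h_Z` with Pauli coefficients `c`: the sum of `c p` times the Pauli
string `p` over the `3 ^ |Z|` Pauli strings whose support is exactly `Z`. -/
def term (c : (V → Fin 4) → ℝ) (Z : Finset V) : Op V :=
  ∑ p ∈ Finset.univ.filter (fun p : V → Fin 4 => supp p = Z), (c p : ℂ) • pauliString p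

/-- The Hamiltonian `∑_Z h_Z`. -/
def hamiltonian (c : (V → Fin 4) → ℝ) : Op V := ∑ Z : Finset V, term c Z

/-- At most `k`-body interactions: `h_Z = 0` for `|Z| > k`. -/
def IsKLocal (c : (V → Fin 4) → ℝ) (k : ℕ) : Prop := ∀ p, k < (supp p).card → c p = 0

/-- Power-law decay: `∑_{Z ∋ i, i'} ‖h_Z‖ ≤ J₀ (d_{i,i'} + 1) ^ (-α)` for all `i, i'`
(`i = i'` included). -/
def PowerLawDecay (G : SimpleGraph V) (c : (V → Fin 4) → ℝ) (J₀ α : ℝ) : Prop :=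
  ∀ i i' : V,
    ∑ Z ∈ Finset.univ.filter (fun Z : Finset V => i ∈ Z ∧ i' ∈ Z), opNorm (term c Z)
      ≤ J₀ * ((G.dist i i' : ℝ) + 1) ^ (-α)

/-- `g` bounds the one-site energy: the sum of `|c p|` over the Pauli strings acting
nontrivially at a given site. -/
def OneSiteEnergyBound (c : (V → Fin 4) → ℝ) (g : ℝ) : Prop :=
  ∀ i : V, ∑ p ∈ Finset.univ.filter (fun p : V → Fin 4 => i ∈ supp p), |c p| ≤ g

/-- `lam` is a constant for the convolution of the power-law decay with itself. -/
def ConvolutionBound (G : SimpleGraph V) (α lam : ℝ) : Prop :=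
  ∀ i i' : V,
    ∑ j : V, ((G.dist i j : ℝ) + 1) ^ (-α) * ((G.dist j i' : ℝ) + 1) ^ (-α)
      ≤ lam * ((G.dist i i' : ℝ) + 1) ^ (-α)

end Operators

/-- `g̃ = max (g k, λ J)` with `J = 3 ^ (k / 2) J₀`. -/
def gTilde (g lam J₀ : ℝ) (k : ℕ) : ℝ :=
  max (g * k) (lam * ((3 : ℝ) ^ ((k : ℝ) / 2) * J₀))

/-- The constant `C₀`. -/
def constC (α J₀ γ gt : ℝ) (D : ℕ) : ℝ :=
  (2 : ℝ) ^ (α - (D : ℝ) / 2 + 2) * J₀ * γ / (2 * α - D - 1)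
    + 80 * gt * γ * (2 : ℝ) ^ (α - (D : ℝ) / 2) / (α - D) * Real.sqrt (2 * α - 2 * D + γ)

end LongRange

end

/-
Fix `Y = X[⌊r/2⌋]` and `R = X[r]`, and split `H = A + B + T`, where `A` collects the terms inside
`Y`, `B` those outside `Y`, and `T` those crossing its boundary. The unitary
`U(t) = e^{iHt} e^{-i(A+B)t}` is generated by `T` evolved with `A + B`. Since `A` acts inside `R`,
the Frobenius distance of `U(t)` to the unitaries acting on `R` grows at most at the rate at which
`T`, evolved with `B` alone, leaks out of `R`; and `W(t)` is the conjugate by `U(t)` of an operator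
acting on `Y`, so its leakage is controlled by that distance.

Every Pauli string in the leakage of the evolved `T` acts on some `i ∈ Y` and some `j ∉ R`. As
Pauli strings are orthogonal, the square of the leakage is at most the sum over these pairs of the
squares of the parts acting on both sites. Each part is bounded by a multiple of
`(d_{i,j} + 1)^{-α}`: this is a Frobenius-norm Lieb–Robinson bound for the terms of `T` through `i`,
obtained from Grönwall's inequality in a frame rotating with the terms that avoid `j`.

It remains to count the pairs `i ∈ Y`, `j ∉ R` at distance `s`. A geodesic from `i` to `j` leaves
`Y` through `(∂X)_{⌊r/2⌋}`, and does so at one of at most `s - (r - ⌊r/2⌋)` times. On a homogeneous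
graph, averaging over the automorphism group turns this into the bound
`(s - (r - ⌊r/2⌋)) |(∂X)_{⌊r/2⌋}| γ s^{D-1}`; under condition (b) the same bound follows by counting
the sites `i` level by level. The sum over `s` telescopes.
-/

noncomputable section

namespace LongRange

open Matrix

section SiteTensor

variable {V n R : Type*} [Fintype V] [CommSemiring R]

/-- The tensor product over all sites of one-site operators, as a matrix indexed by the
configurations `V → n`. -/
def siteTensor (M : V → Matrix n n R) : Matrix (V → n) (V → n) R :=
  fun σ τ => ∏ i, M i (σ i) (τ i)

lemma siteTensor_mul [DecidableEq V] [Fintype n] (M N : V → Matrix n n R) :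
    siteTensor M * siteTensor N = siteTensor fun i => M i * N i := by
  ext σ τ
  simp only [Matrix.mul_apply, siteTensor, Finset.prod_univ_sum, Fintype.piFinset_univ,
    Finset.prod_mul_distrib]

lemma siteTensor_one [DecidableEq n] :
    siteTensor (fun _ : V => (1 : Matrix n n R)) = 1 := by
  ext σ τ
  simp only [siteTensor, Matrix.one_apply, Finset.prod_ite_zero, Finset.prod_const_one,
    Finset.mem_univ, true_imp_iff, funext_iff]

lemma conjTranspose_siteTensor [StarRing R] (M : V → Matrix n n R) :
    (siteTensor M)ᴴ = siteTensor fun i => (M i)ᴴ := by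
  ext σ τ
  simp only [siteTensor, Matrix.conjTranspose_apply, star_prod]

lemma trace_siteTensor [DecidableEq V] [Fintype n] (M : V → Matrix n n R) :
    (siteTensor M).trace = ∏ i, (M i).trace := by
  simp only [Matrix.trace, siteTensor, Matrix.diag_apply, Finset.prod_univ_sum,
    Fintype.piFinset_univ]

end SiteTensor

section PauliMatrices

lemma pauli_zero : pauli 0 = 1 := rfl

lemma trace_pauli {a : Fin 4} (ha : a ≠ 0) : (pauli a).trace = 0 := by
  fin_cases a <;> simp_all [pauli, Matrix.trace]

lemma isHermitian_pauli (a : Fin 4) : (pauli a).IsHermitian := by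
  fin_cases a <;> ext i j <;> fin_cases i <;> fin_cases j <;> simp [pauli]

lemma trace_pauli_mul_pauli (a b : Fin 4) :
    (pauli a * pauli b).trace = if a = b then 2 else 0 := by
  fin_cases a <;> fin_cases b <;> simp [pauli, Matrix.trace] <;> norm_num

lemma sum_pauli_mul_pauli (a b a' b' : Fin 2) :
    ∑ q : Fin 4, pauli q a b * pauli q b' a' = if a = a' ∧ b = b' then 2 else 0 := by
  fin_cases a <;> fin_cases b <;> fin_cases a' <;> fin_cases b' <;>
    simp [Fin.sum_univ_four, pauli] <;> norm_num

end PauliMatrices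

section PauliStrings

variable {V : Type*} [Fintype V]

lemma pauliString_eq_siteTensor (p : V → Fin 4) :
    pauliString p = siteTensor fun i => pauli (p i) := rfl

lemma isHermitian_pauliString (p : V → Fin 4) : (pauliString p).IsHermitian := by
  rw [Matrix.IsHermitian, pauliString_eq_siteTensor, conjTranspose_siteTensor]
  simp only [(isHermitian_pauli _).eq]

lemma mem_supp {p : V → Fin 4} {i : V} : i ∈ supp p ↔ p i ≠ 0 := by simp [supp]

lemma notMem_supp {p : V → Fin 4} {i : V} : i ∉ supp p ↔ p i = 0 := by
  rw [mem_supp, not_not]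

lemma pauliString_zero : pauliString (0 : V → Fin 4) = 1 := siteTensor_one

variable [DecidableEq V]

lemma trace_pauliString_mul_pauliString (p q : V → Fin 4) :
    (pauliString p * pauliString q).trace = if p = q then (2 : ℂ) ^ Fintype.card V else 0 := by
  simp only [pauliString_eq_siteTensor, siteTensor_mul, trace_siteTensor, trace_pauli_mul_pauli,
    Fintype.prod_ite_zero, Finset.prod_const, Finset.card_univ, funext_iff]

lemma sum_pauliString_mul_pauliString (σ τ σ' τ' : V → Fin 2) :
    ∑ p : V → Fin 4, pauliString p σ τ * pauliString p τ' σ' =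
      if σ = σ' ∧ τ = τ' then (2 : ℂ) ^ Fintype.card V else 0 := by
  have factor : ∑ p : V → Fin 4, pauliString p σ τ * pauliString p τ' σ' =
      ∏ i, ∑ a, pauli a (σ i) (τ i) * pauli a (τ' i) (σ' i) := by
    simp only [pauliString, ← Finset.prod_mul_distrib, Finset.prod_univ_sum,
      Fintype.piFinset_univ]
  simp only [factor, sum_pauli_mul_pauli, Fintype.prod_ite_zero, Finset.prod_const,
    Finset.card_univ, forall_and, funext_iff]

lemma commute_pauliString {p q : V → Fin 4} (h : Disjoint (supp p) (supp q)) :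
    Commute (pauliString p) (pauliString q) := by
  have site : ∀ i, Commute (pauli (p i)) (pauli (q i)) := fun i => by
    by_cases hp : p i = 0
    · simp only [hp, pauli_zero, Commute.one_left]
    · have hq : q i = 0 := notMem_supp.1 (Finset.disjoint_left.1 h (mem_supp.2 hp))
      simp only [hq, pauli_zero, Commute.one_right]
  simp only [commute_iff_eq, pauliString_eq_siteTensor, siteTensor_mul, (site _).eq]

/-- The coefficient of a Pauli string in the Pauli expansion of an operator. -/
def pauliCoeff (p : V → Fin 4) : Op V →ₗ[ℂ] ℂ :=
  ((2 : ℂ) ^ Fintype.card V)⁻¹ • Matrix.traceLinearMap _ ℂ ℂ ∘ₗ LinearMap.mulLeft ℂ (pauliString p)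

lemma pauliCoeff_apply (p : V → Fin 4) (A : Op V) :
    pauliCoeff p A = ((2 : ℂ) ^ Fintype.card V)⁻¹ * (pauliString p * A).trace := rfl

lemma sum_pauliCoeff_smul (A : Op V) : ∑ p, pauliCoeff p A • pauliString p = A := by
  ext σ τ
  simp only [Matrix.sum_apply, Matrix.smul_apply, smul_eq_mul, pauliCoeff_apply, Matrix.trace,
    Matrix.diag_apply, Matrix.mul_apply]
  calc ∑ p, ((2 : ℂ) ^ Fintype.card V)⁻¹ * (∑ a, ∑ b, pauliString p a b * A b a)
          * pauliString p σ τ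
      = ((2 : ℂ) ^ Fintype.card V)⁻¹ * ∑ a, ∑ b, A b a *
          ∑ p, pauliString p σ τ * pauliString p a b := by
        simp only [Finset.mul_sum, Finset.sum_mul]
        rw [Finset.sum_comm]
        refine Finset.sum_congr rfl fun a _ => ?_
        rw [Finset.sum_comm]
        exact Finset.sum_congr rfl fun b _ => Finset.sum_congr rfl fun p _ => by ring
    _ = ((2 : ℂ) ^ Fintype.card V)⁻¹ * (A σ τ * (2 : ℂ) ^ Fintype.card V) := by
        simp only [sum_pauliString_mul_pauliString, ite_and, mul_ite, mul_zero,
          Finset.sum_ite_eq, Finset.mem_univ, if_true]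
    _ = A σ τ := by field_simp

lemma pauliCoeff_pauliString (p q : V → Fin 4) :
    pauliCoeff p (pauliString q) = if p = q then 1 else 0 := by
  rw [pauliCoeff_apply, trace_pauliString_mul_pauliString, mul_ite, mul_zero,
    inv_mul_cancel₀ (pow_ne_zero _ two_ne_zero)]

lemma ext_pauliCoeff {A B : Op V} (h : ∀ p, pauliCoeff p A = pauliCoeff p B) : A = B := by
  rw [← sum_pauliCoeff_smul A, ← sum_pauliCoeff_smul B]
  simp only [h]

end PauliStrings

section LocalAlgebra

variable {V : Type*} [DecidableEq V]

lemma extend_siteTensor [Fintype V] (S : Finset V) (M : {i // i ∈ S} → Matrix (Fin 2) (Fin 2) ℂ) :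
    extend S (siteTensor M) = siteTensor fun i => if h : i ∈ S then M ⟨i, h⟩ else 1 := by
  ext σ τ
  have outside : ∏ i : {i // i ∉ S}, (1 : Matrix (Fin 2) (Fin 2) ℂ) (σ i) (τ i) =
      if ∀ i, i ∉ S → σ i = τ i then 1 else 0 := by
    simp only [Matrix.one_apply, Finset.prod_ite_zero, Finset.prod_const_one, Finset.mem_univ,
      true_imp_iff, Subtype.forall]
  have off_S : ∀ i : {i // i ∉ S}, (if h : (i : V) ∈ S then M ⟨i, h⟩ else 1) = 1 :=
    fun i => dif_neg i.2
  simp only [siteTensor, extend]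
  rw [← Fintype.prod_subtype_mul_prod_subtype (· ∈ S)]
  simp only [Subtype.prop, dite_true, off_S, outside, mul_ite, mul_one, mul_zero]
  congr!

variable [Fintype V]

lemma partialTrace_siteTensor (S : Finset V) (M : V → Matrix (Fin 2) (Fin 2) ℂ) :
    partialTrace S (siteTensor M) =
      (∏ i : {i // i ∉ S}, (M i).trace) • siteTensor fun i : {i // i ∈ S} => M i := by
  ext a a'
  have split : ∀ b : {i // i ∉ S} → Fin 2, ∏ i, M i (glue S a b i) (glue S a' b i) =
      (∏ i : {i // i ∉ S}, M i (b i) (b i)) * ∏ i : {i // i ∈ S}, M i (a i) (a' i) := fun b => by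
    rw [← Fintype.prod_subtype_mul_prod_subtype (· ∈ S), mul_comm]
    congr 1
    · exact Finset.prod_congr rfl fun i _ => by simp only [glue, i.2, dite_false]
    · exact Finset.prod_congr (Finset.ext fun _ => by simp only [Finset.mem_univ]) fun i _ => by
        simp only [glue, i.2, dite_true]
  simp only [partialTrace, siteTensor, Matrix.smul_apply, smul_eq_mul, split, ← Finset.sum_mul,
    Matrix.trace, Matrix.diag_apply, Finset.prod_univ_sum, Fintype.piFinset_univ]

lemma localApprox_siteTensor (S : Finset V) (M : V → Matrix (Fin 2) (Fin 2) ℂ) :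
    localApprox S (siteTensor M) =
      (∏ i : {i // i ∉ S}, (M i).trace / 2) • siteTensor fun i => if i ∈ S then M i else 1 := by
  ext σ τ
  have extended := congrFun₂ (extend_siteTensor S fun i : {i // i ∈ S} => M i) σ τ
  simp only [dite_eq_ite] at extended
  simp only [localApprox, partialTrace_siteTensor, Matrix.smul_apply, smul_eq_mul, ← extended,
    extend, Finset.prod_div_distrib, Finset.prod_const, Finset.card_univ, Matrix.trace_one,
    Fintype.card_fun, Fintype.card_fin, Nat.cast_pow, Nat.cast_ofNat, mul_ite, mul_zero]
  congr 1
  ring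

/-- The projection `localApprox S` as a linear map. -/
def localApproxₗ (S : Finset V) : Op V →ₗ[ℂ] Op V where
  toFun := localApprox S
  map_add' A B := by
    ext σ τ
    simp only [localApprox, extend, partialTrace, Matrix.smul_apply, Matrix.add_apply,
      Finset.sum_add_distrib, ← smul_add]
    split_ifs <;> simp only [add_zero]
  map_smul' z A := by
    ext σ τ
    simp only [localApprox, extend, partialTrace, Matrix.smul_apply, ← Finset.smul_sum,
      RingHom.id_apply, smul_comm z, smul_ite, smul_zero]

lemma localApproxₗ_apply (S : Finset V) (A : Op V) : localApproxₗ S A = localApprox S A := rfl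

lemma localApproxₗ_pauliString (S : Finset V) (p : V → Fin 4) :
    localApproxₗ S (pauliString p) = if supp p ⊆ S then pauliString p else 0 := by
  rw [localApproxₗ_apply, pauliString_eq_siteTensor, localApprox_siteTensor]
  split_ifs with h
  · have hp : ∀ i, i ∉ S → p i = 0 := fun i hi => notMem_supp.1 fun hip => hi (h hip)
    have trace_eq : ∀ i : {i // i ∉ S}, (pauli (p i)).trace / 2 = 1 := fun i => by
      rw [hp i i.2, pauli_zero, Matrix.trace_one, Fintype.card_fin, Nat.cast_ofNat,
        div_self two_ne_zero]
    have pauli_eq : ∀ i, (if i ∈ S then pauli (p i) else 1) = pauli (p i) := fun i => by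
      split_ifs with hi
      · rfl
      · rw [hp i hi, pauli_zero]
    simp only [trace_eq, pauli_eq, Finset.prod_const_one, one_smul]
  · obtain ⟨i, hi, hiS⟩ := Finset.not_subset.mp h
    rw [Finset.prod_eq_zero (Finset.mem_univ ⟨i, hiS⟩), zero_smul]
    rw [trace_pauli (mem_supp.1 hi), zero_div]

lemma pauliCoeff_localApproxₗ (S : Finset V) (p : V → Fin 4) (A : Op V) :
    pauliCoeff p (localApproxₗ S A) = if supp p ⊆ S then pauliCoeff p A else 0 := by
  conv_lhs => rw [← sum_pauliCoeff_smul A]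
  simp only [map_sum, map_smul, localApproxₗ_pauliString, apply_ite (pauliCoeff p), map_zero,
    pauliCoeff_pauliString, smul_eq_mul, mul_ite, mul_one, mul_zero]
  rw [Finset.sum_eq_single p (fun q _ hq => by simp only [if_neg hq.symm, ite_self])
    (fun hp => absurd (Finset.mem_univ p) hp), if_pos rfl]

lemma localApproxₗ_conjTranspose (S : Finset V) (A : Op V) :
    localApproxₗ S Aᴴ = (localApproxₗ S A)ᴴ := by
  ext σ τ
  simp only [localApproxₗ_apply, localApprox, extend, partialTrace, Matrix.conjTranspose_apply,
    Matrix.smul_apply, star_smul, apply_ite star, star_sum, star_zero, star_inv₀,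
    Matrix.trace_one, star_natCast, eq_comm (a := τ _)]

lemma actsOn_localApproxₗ (S : Finset V) (A : Op V) : ActsOn S (localApproxₗ S A) := by
  refine ⟨(Matrix.trace (1 : Op {i // i ∉ S}))⁻¹ • partialTrace S A, ?_⟩
  ext σ τ
  simp only [localApproxₗ_apply, localApprox, extend, Matrix.smul_apply, smul_ite, smul_zero]

lemma localApproxₗ_extend (S : Finset V) (w : Op {i // i ∈ S}) :
    localApproxₗ S (extend S w) = extend S w := by
  have trace_extend : partialTrace S (extend S w) = (2 : ℂ) ^ Fintype.card {i // i ∉ S} • w := by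
    ext a a'
    have glue_in : ∀ (a : {i // i ∈ S} → Fin 2) b, (fun i : {i // i ∈ S} => glue S a b i) = a :=
      fun a b => by
        ext i
        simp only [glue, i.2, dite_true]
    have agree : ∀ b i, i ∉ S → glue S a b i = glue S a' b i := fun b i hi => by
      simp only [glue, hi, dite_false]
    simp only [partialTrace, extend, glue_in, if_pos (agree _), Finset.sum_const,
      Finset.card_univ, Fintype.card_fun, Fintype.card_fin, Matrix.smul_apply, nsmul_eq_mul,
      Nat.cast_pow, Nat.cast_ofNat, smul_eq_mul]
  ext σ τ
  simp only [localApproxₗ_apply, localApprox, trace_extend, Matrix.smul_apply, extend,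
    Matrix.trace_one, Fintype.card_fun, Fintype.card_fin, Nat.cast_pow, Nat.cast_ofNat,
    smul_eq_mul, mul_ite, mul_zero, inv_mul_cancel_left₀ (pow_ne_zero _ (two_ne_zero (α := ℂ)))]

lemma actsOn_iff_localApproxₗ_eq {S : Finset V} {A : Op V} :
    ActsOn S A ↔ localApproxₗ S A = A := by
  refine ⟨?_, fun h => h ▸ actsOn_localApproxₗ S A⟩
  rintro ⟨w, rfl⟩
  exact localApproxₗ_extend S w

lemma ActsOn.eq_sum {S : Finset V} {A : Op V} (hA : ActsOn S A) :
    A = ∑ p with supp p ⊆ S, pauliCoeff p A • pauliString p := by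
  conv_lhs => rw [← actsOn_iff_localApproxₗ_eq.1 hA, ← sum_pauliCoeff_smul A]
  simp only [map_sum, map_smul, localApproxₗ_pauliString, smul_ite, smul_zero, Finset.sum_filter]

lemma localApproxₗ_pauliString_mul {S : Finset V} {q : V → Fin 4} (hq : supp q ⊆ S)
    (p : V → Fin 4) : localApproxₗ S (pauliString q * pauliString p) =
      pauliString q * localApproxₗ S (pauliString p) := by
  have hq' : ∀ i, i ∉ S → pauli (q i) = 1 := fun i hi => by
    rw [notMem_supp.1 fun hiq => hi (hq hiq), pauli_zero]
  simp only [localApproxₗ_apply, pauliString_eq_siteTensor, siteTensor_mul,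
    localApprox_siteTensor, Matrix.mul_smul]
  congr 2
  · ext i
    rw [hq' i i.2, one_mul]
  · ext1 i
    split_ifs with hi
    · rfl
    · rw [hq' i hi, one_mul]

lemma ActsOn.localApproxₗ_mul {S : Finset V} {B : Op V} (hB : ActsOn S B) (A : Op V) :
    localApproxₗ S (B * A) = B * localApproxₗ S A := by
  rw [hB.eq_sum, ← sum_pauliCoeff_smul A]
  simp only [Finset.sum_mul, Finset.mul_sum, map_sum, map_smul, Matrix.smul_mul, Matrix.mul_smul]
  refine Finset.sum_congr rfl fun p _ => Finset.sum_congr rfl fun q hq => ?_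
  rw [localApproxₗ_pauliString_mul (Finset.mem_filter.1 hq).2]

lemma ActsOn.mul {S : Finset V} {A B : Op V} (hA : ActsOn S A) (hB : ActsOn S B) :
    ActsOn S (A * B) := by
  rw [actsOn_iff_localApproxₗ_eq, hA.localApproxₗ_mul, actsOn_iff_localApproxₗ_eq.1 hB]

/-- The algebra of the operators acting on the spins in `S`; `localApprox S` is the conditional
expectation onto it. -/
def localAlgebra (S : Finset V) : StarSubalgebra ℂ (Op V) where
  carrier := {A | ActsOn S A}
  mul_mem' := ActsOn.mul
  add_mem' hA hB := actsOn_iff_localApproxₗ_eq.2 <| by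
    rw [map_add, actsOn_iff_localApproxₗ_eq.1 hA, actsOn_iff_localApproxₗ_eq.1 hB]
  algebraMap_mem' z := actsOn_iff_localApproxₗ_eq.2 <| by
    have supp_zero : supp (0 : V → Fin 4) ⊆ S := fun i hi =>
      absurd (Pi.zero_apply i) (mem_supp.1 hi)
    rw [Algebra.algebraMap_eq_smul_one, ← pauliString_zero, map_smul, localApproxₗ_pauliString,
      if_pos supp_zero]
  star_mem' hA := actsOn_iff_localApproxₗ_eq.2 <| by
    rw [Matrix.star_eq_conjTranspose, localApproxₗ_conjTranspose,
      actsOn_iff_localApproxₗ_eq.1 hA]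

variable {S T : Finset V} {A B : Op V}

lemma mem_localAlgebra : A ∈ localAlgebra S ↔ localApproxₗ S A = A := actsOn_iff_localApproxₗ_eq

lemma mem_localAlgebra_iff_pauliCoeff :
    A ∈ localAlgebra S ↔ ∀ p, ¬ supp p ⊆ S → pauliCoeff p A = 0 := by
  rw [mem_localAlgebra]
  constructor
  · intro h p hp
    rw [← h, pauliCoeff_localApproxₗ, if_neg hp]
  · refine fun h => ext_pauliCoeff fun p => ?_
    rw [pauliCoeff_localApproxₗ]
    split_ifs with hp
    · rfl
    · exact (h p hp).symm

lemma localApproxₗ_mem (S : Finset V) (A : Op V) : localApproxₗ S A ∈ localAlgebra S :=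
  actsOn_localApproxₗ S A

lemma localAlgebra_mono (h : S ⊆ T) : localAlgebra S ≤ localAlgebra T := fun _ hA =>
  mem_localAlgebra_iff_pauliCoeff.2 fun p hp =>
    mem_localAlgebra_iff_pauliCoeff.1 hA p fun hs => hp (hs.trans h)

lemma localApproxₗ_mul_of_mem (hB : B ∈ localAlgebra S) (A : Op V) :
    localApproxₗ S (B * A) = B * localApproxₗ S A := ActsOn.localApproxₗ_mul hB A

lemma localApproxₗ_mul_of_mem_right (hB : B ∈ localAlgebra S) (A : Op V) :
    localApproxₗ S (A * B) = localApproxₗ S A * B := by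
  have star_B : Bᴴ ∈ localAlgebra S := star_mem hB
  rw [← Matrix.conjTranspose_inj, ← localApproxₗ_conjTranspose, Matrix.conjTranspose_mul,
    localApproxₗ_mul_of_mem star_B, Matrix.conjTranspose_mul, localApproxₗ_conjTranspose]

lemma commute_of_disjoint (hA : A ∈ localAlgebra S) (hB : B ∈ localAlgebra T)
    (h : Disjoint S T) : Commute A B := by
  rw [ActsOn.eq_sum hA, ActsOn.eq_sum hB]
  refine Commute.sum_left _ _ _ fun p hp => Commute.sum_right _ _ _ fun q hq => ?_
  exact ((commute_pauliString (h.mono (Finset.mem_filter.1 hp).2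
    (Finset.mem_filter.1 hq).2)).smul_left _).smul_right _

open scoped Matrix.Norms.Frobenius in
lemma exp_mem_localAlgebra (hA : A ∈ localAlgebra S) : NormedSpace.exp A ∈ localAlgebra S :=
  NormedSpace.exp_mem (R := ℂ) (s := localAlgebra S) (Submodule.closed_of_finiteDimensional
    (Subalgebra.toSubmodule (localAlgebra S).toSubalgebra)) hA

end LocalAlgebra

section FrobeniusNorm

open scoped Matrix.Norms.Frobenius

variable {m n 𝕜 : Type*} [Fintype m] [Fintype n] [RCLike 𝕜]

lemma frobenius_norm_sq (A : Matrix m n 𝕜) : ‖A‖ ^ 2 = ∑ i, ∑ j, ‖A i j‖ ^ 2 := by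
  simp only [Matrix.frobenius_norm_def, ← Real.sqrt_eq_rpow, Real.rpow_two]
  exact Real.sq_sqrt (by positivity)

lemma trace_conjTranspose_mul_self (A : Matrix m n 𝕜) : (Aᴴ * A).trace = ((‖A‖ ^ 2 : ℝ) : 𝕜) := by
  simp only [frobenius_norm_sq, Finset.sum_comm (s := (Finset.univ : Finset m)), Matrix.trace,
    Matrix.diag_apply, Matrix.mul_apply, Matrix.conjTranspose_apply, map_sum, map_pow]
  exact Finset.sum_congr rfl fun i _ => Finset.sum_congr rfl fun j _ => RCLike.conj_mul _

lemma frobenius_norm_sq_eq_sum_col (A : Matrix m n 𝕜) :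
    ‖A‖ ^ 2 = ∑ j, ‖WithLp.toLp 2 (A.col j)‖ ^ 2 := by
  simp only [frobenius_norm_sq, Finset.sum_comm (s := (Finset.univ : Finset m)),
    EuclideanSpace.norm_sq_eq, Matrix.col_apply]

variable [DecidableEq n] {U : Matrix n n 𝕜}

lemma frobenius_norm_unitary_mul (hU : U ∈ unitary (Matrix n n 𝕜)) (A : Matrix n m 𝕜) :
    ‖U * A‖ = ‖A‖ := by
  have hU' : Uᴴ * U = 1 := Unitary.star_mul_self_of_mem hU
  have norm_sq : ((‖U * A‖ ^ 2 : ℝ) : 𝕜) = ((‖A‖ ^ 2 : ℝ) : 𝕜) := by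
    rw [← trace_conjTranspose_mul_self, ← trace_conjTranspose_mul_self, Matrix.conjTranspose_mul,
      Matrix.mul_assoc, ← Matrix.mul_assoc Uᴴ, hU', Matrix.one_mul]
  exact (sq_eq_sq₀ (norm_nonneg _) (norm_nonneg _)).1 (RCLike.ofReal_inj.1 norm_sq)

lemma frobenius_norm_mul_unitary (hU : U ∈ unitary (Matrix n n 𝕜)) (A : Matrix m n 𝕜) :
    ‖A * U‖ = ‖A‖ := by
  have hU' : Uᴴ ∈ unitary (Matrix n n 𝕜) := Unitary.star_mem hU
  rw [← Matrix.frobenius_norm_conjTranspose (A * U), Matrix.conjTranspose_mul,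
    frobenius_norm_unitary_mul hU', Matrix.frobenius_norm_conjTranspose]

lemma frobenius_norm_mul_le_toEuclideanCLM_left (A : Matrix n n 𝕜) (B : Matrix n m 𝕜) :
    ‖A * B‖ ≤ ‖Matrix.toEuclideanCLM (𝕜 := 𝕜) A‖ * ‖B‖ := by
  refine le_of_sq_le_sq ?_ (by positivity)
  rw [mul_pow, frobenius_norm_sq_eq_sum_col, frobenius_norm_sq_eq_sum_col, Finset.mul_sum]
  refine Finset.sum_le_sum fun j _ => ?_
  rw [← mul_pow]
  gcongr
  exact (Matrix.toEuclideanCLM (𝕜 := 𝕜) A).le_opNorm (WithLp.toLp 2 (B.col j))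

end FrobeniusNorm

section OperatorNorm

open scoped Matrix.Norms.Frobenius

variable {V : Type*} [Fintype V] [DecidableEq V]

lemma opNorm_nonneg (A : Op V) : 0 ≤ opNorm A := norm_nonneg _

lemma opNorm_neg (A : Op V) : opNorm (-A) = opNorm A := by
  rw [opNorm, map_neg, norm_neg, opNorm]

lemma opNorm_mul_le (A B : Op V) : opNorm (A * B) ≤ opNorm A * opNorm B := by
  simp only [opNorm, map_mul]
  exact norm_mul_le _ _

lemma opNorm_conjTranspose (A : Op V) : opNorm Aᴴ = opNorm A := by
  rw [opNorm, opNorm, ← Matrix.star_eq_conjTranspose, map_star]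
  exact norm_star (Matrix.toEuclideanCLM (𝕜 := ℂ) A)

lemma opNorm_le_one_of_mem_unitary {U : Op V} (hU : U ∈ unitary (Op V)) : opNorm U ≤ 1 := by
  rw [opNorm, CStarRing.norm_of_mem_unitary (Unitary.map_mem Matrix.toEuclideanCLM hU)]

lemma norm_mul_le_opNorm_mul (A B : Op V) : ‖A * B‖ ≤ opNorm A * ‖B‖ :=
  frobenius_norm_mul_le_toEuclideanCLM_left A B

lemma norm_mul_le_mul_opNorm (A B : Op V) : ‖A * B‖ ≤ ‖A‖ * opNorm B := by
  rw [← Matrix.frobenius_norm_conjTranspose (A * B), Matrix.conjTranspose_mul, mul_comm,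
    ← opNorm_conjTranspose, ← Matrix.frobenius_norm_conjTranspose A]
  exact norm_mul_le_opNorm_mul _ _

lemma norm_one_op : ‖(1 : Op V)‖ = √(2 ^ Fintype.card V) := by
  rw [← coe_nnnorm, Matrix.frobenius_nnnorm_one, NNReal.coe_mul, Real.coe_sqrt, nnnorm_one,
    NNReal.coe_one, mul_one, Fintype.card_fun, Fintype.card_fin, NNReal.coe_natCast, Nat.cast_pow,
    Nat.cast_ofNat]

lemma norm_le_opNorm (A : Op V) : ‖A‖ ≤ opNorm A * √(2 ^ Fintype.card V) := by
  simpa only [mul_one, norm_one_op] using norm_mul_le_opNorm_mul A 1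

lemma frobNorm_eq (A : Op V) : frobNorm A = ‖A‖ / √(2 ^ Fintype.card V) := by
  have trace_re : (Aᴴ * A).trace.re = ‖A‖ ^ 2 := by
    rw [trace_conjTranspose_mul_self]
    exact Complex.ofReal_re _
  rw [frobNorm, trace_re, Matrix.trace_one, Real.sqrt_div (sq_nonneg _),
    Real.sqrt_sq (norm_nonneg _), Fintype.card_fun, Fintype.card_fin, Complex.natCast_re,
    Nat.cast_pow, Nat.cast_ofNat]

end OperatorNorm

section Leakage

open scoped Matrix.Norms.Frobenius

variable {V : Type*} [Fintype V] [DecidableEq V] {S T : Finset V} {A B : Op V}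

lemma norm_sq_eq_sum_pauliCoeff (A : Op V) :
    ‖A‖ ^ 2 = 2 ^ Fintype.card V * ∑ p, ‖pauliCoeff p A‖ ^ 2 := by
  have parseval : ((‖A‖ ^ 2 : ℝ) : ℂ) =
      ((2 ^ Fintype.card V * ∑ p, ‖pauliCoeff p A‖ ^ 2 : ℝ) : ℂ) := by
    calc ((‖A‖ ^ 2 : ℝ) : ℂ) = (Aᴴ * A).trace := (trace_conjTranspose_mul_self A).symm
      _ = ∑ p, star (pauliCoeff p A) * (pauliString p * A).trace := by
          conv_lhs => enter [1, 1]; rw [← sum_pauliCoeff_smul A]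
          simp only [Matrix.conjTranspose_sum, Matrix.conjTranspose_smul,
            (isHermitian_pauliString _).eq, Finset.sum_mul, Matrix.trace_sum, Matrix.smul_mul,
            Matrix.trace_smul, smul_eq_mul]
      _ = ∑ p, 2 ^ Fintype.card V * ((‖pauliCoeff p A‖ : ℂ) ^ 2) := by
          refine Finset.sum_congr rfl fun p _ => ?_
          rw [← Complex.conj_mul', Complex.star_def, pauliCoeff_apply]
          field_simp
      _ = _ := by push_cast; rw [Finset.mul_sum]
  exact_mod_cast parseval

lemma norm_le_of_pauliCoeff_le (h : ∀ p, ‖pauliCoeff p A‖ ≤ ‖pauliCoeff p B‖) : ‖A‖ ≤ ‖B‖ := by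
  refine le_of_sq_le_sq ?_ (norm_nonneg _)
  rw [norm_sq_eq_sum_pauliCoeff, norm_sq_eq_sum_pauliCoeff]
  gcongr with p
  exact h p

/-- The part of an operator that leaks out of `S`: the sum of the Pauli strings in its expansion
that do not act inside `S`. -/
def leakage (S : Finset V) : Op V →ₗ[ℂ] Op V := LinearMap.id - localApproxₗ S

lemma leakage_apply (S : Finset V) (A : Op V) : leakage S A = A - localApproxₗ S A := rfl

lemma pauliCoeff_leakage (S : Finset V) (p : V → Fin 4) (A : Op V) :
    pauliCoeff p (leakage S A) = if supp p ⊆ S then 0 else pauliCoeff p A := by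
  rw [leakage_apply, map_sub, pauliCoeff_localApproxₗ]
  split_ifs <;> ring

lemma leakage_comm (S T : Finset V) (A : Op V) :
    leakage S (leakage T A) = leakage T (leakage S A) := by
  refine ext_pauliCoeff fun p => ?_
  simp only [pauliCoeff_leakage]
  split_ifs <;> rfl

lemma leakage_eq_zero (hA : A ∈ localAlgebra S) : leakage S A = 0 := by
  rw [leakage_apply, mem_localAlgebra.1 hA, sub_self]

lemma leakage_mul_of_mem (hB : B ∈ localAlgebra S) (A : Op V) :
    leakage S (B * A) = B * leakage S A := by
  rw [leakage_apply, localApproxₗ_mul_of_mem hB, leakage_apply, mul_sub]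

lemma leakage_mul_of_mem_right (hB : B ∈ localAlgebra S) (A : Op V) :
    leakage S (A * B) = leakage S A * B := by
  rw [leakage_apply, localApproxₗ_mul_of_mem_right hB, leakage_apply, sub_mul]

lemma norm_leakage_le_norm_sub (hB : B ∈ localAlgebra S) (A : Op V) :
    ‖leakage S A‖ ≤ ‖A - B‖ := by
  refine norm_le_of_pauliCoeff_le fun p => ?_
  rw [pauliCoeff_leakage, map_sub]
  split_ifs with h
  · rw [norm_zero]
    exact norm_nonneg _
  · rw [mem_localAlgebra_iff_pauliCoeff.1 hB p h, sub_zero]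

lemma norm_leakage_le (S : Finset V) (A : Op V) : ‖leakage S A‖ ≤ ‖A‖ := by
  simpa only [sub_zero] using norm_leakage_le_norm_sub (zero_mem (localAlgebra S)) A

/-- The part of an operator made of the Pauli strings acting nontrivially at the site `j`. -/
def sitePart (j : V) : Op V →ₗ[ℂ] Op V := leakage {j}ᶜ

lemma subset_compl_singleton {α : Type*} [Fintype α] [DecidableEq α] {j : α} {S : Finset α} :
    S ⊆ {j}ᶜ ↔ j ∉ S := by
  rw [Finset.subset_compl_comm, Finset.singleton_subset_iff, Finset.mem_compl]

lemma pauliCoeff_sitePart (j : V) (p : V → Fin 4) (A : Op V) :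
    pauliCoeff p (sitePart j A) = if j ∈ supp p then pauliCoeff p A else 0 := by
  simp only [sitePart, pauliCoeff_leakage, subset_compl_singleton, ite_not]

lemma sitePart_eq_zero {j : V} (hA : A ∈ localAlgebra S) (hj : j ∉ S) : sitePart j A = 0 :=
  leakage_eq_zero (localAlgebra_mono (subset_compl_singleton.2 hj) hA)

lemma norm_leakage_sq_le (S : Finset V) (A : Op V) :
    ‖leakage S A‖ ^ 2 ≤ ∑ j ∈ Sᶜ, ‖sitePart j A‖ ^ 2 := by
  simp only [norm_sq_eq_sum_pauliCoeff, ← Finset.mul_sum]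
  gcongr
  rw [Finset.sum_comm]
  refine Finset.sum_le_sum fun p _ => ?_
  rw [pauliCoeff_leakage]
  split_ifs with h
  · rw [norm_zero, zero_pow two_ne_zero]
    positivity
  · obtain ⟨j, hjp, hjS⟩ := Finset.not_subset.1 h
    refine le_trans ?_ (Finset.single_le_sum (fun _ _ => by positivity) (Finset.mem_compl.2 hjS))
    rw [pauliCoeff_sitePart, if_pos hjp]

lemma norm_leakage_leakage_sq_le (S T : Finset V) (A : Op V) :
    ‖leakage T (leakage S A)‖ ^ 2 ≤ ∑ i ∈ Sᶜ, ∑ j ∈ Tᶜ, ‖sitePart j (sitePart i A)‖ ^ 2 := by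
  rw [leakage_comm]
  refine (norm_leakage_sq_le S _).trans (Finset.sum_le_sum fun i _ => ?_)
  rw [sitePart, leakage_comm]
  exact norm_leakage_sq_le T _

lemma norm_leakage_compl_le_sum (S : Finset V) (A : Op V) :
    ‖leakage Sᶜ A‖ ≤ ∑ j ∈ S, ‖sitePart j A‖ := by
  refine le_of_sq_le_sq ((norm_leakage_sq_le Sᶜ A).trans ?_) (by positivity)
  rw [compl_compl]
  exact Finset.sum_sq_le_sq_sum_of_nonneg fun _ _ => norm_nonneg _

lemma norm_commutator_le (hB : B ∈ localAlgebra S) (A : Op V) :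
    ‖B * A - A * B‖ ≤ 2 * opNorm B * ∑ j ∈ S, ‖sitePart j A‖ := by
  have comm : B * localApproxₗ Sᶜ A = localApproxₗ Sᶜ A * B :=
    commute_of_disjoint hB (localApproxₗ_mem Sᶜ A) disjoint_compl_right
  calc ‖B * A - A * B‖ = ‖B * leakage Sᶜ A - leakage Sᶜ A * B‖ := by
        rw [leakage_apply, mul_sub, sub_mul, comm, sub_sub_sub_cancel_right]
    _ ≤ opNorm B * ‖leakage Sᶜ A‖ + ‖leakage Sᶜ A‖ * opNorm B :=
        (norm_sub_le _ _).trans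
          (add_le_add (norm_mul_le_opNorm_mul _ _) (norm_mul_le_mul_opNorm _ _))
    _ = 2 * opNorm B * ‖leakage Sᶜ A‖ := by ring
    _ ≤ 2 * opNorm B * ∑ j ∈ S, ‖sitePart j A‖ :=
        mul_le_mul_of_nonneg_left (norm_leakage_compl_le_sum S A)
          (mul_nonneg zero_le_two (opNorm_nonneg B))

end Leakage

section Propagator

open scoped Matrix.Norms.Frobenius

variable {V : Type*} [Fintype V] [DecidableEq V] {S : Finset V} {H A : Op V}

/-- The propagator `exp (iHt)` of the Heisenberg evolution generated by `H`. -/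
def propagator (H : Op V) (t : ℝ) : Op V := NormedSpace.exp ((Complex.I * (t : ℂ)) • H)

lemma evolve_eq (H : Op V) (t : ℝ) (W : Op V) :
    evolve H t W = propagator H t * W * propagator H (-t) := by
  rw [evolve, propagator, propagator, Complex.ofReal_neg, mul_neg]

lemma propagator_zero (H : Op V) : propagator H 0 = 1 := by
  rw [propagator, Complex.ofReal_zero, mul_zero, zero_smul, NormedSpace.exp_zero]

lemma evolve_zero (H W : Op V) : evolve H 0 W = W := by
  rw [evolve_eq, neg_zero, propagator_zero, one_mul, mul_one]

lemma propagator_neg (H : Op V) (t : ℝ) : propagator (-H) t = propagator H (-t) := by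
  rw [propagator, propagator, smul_neg, Complex.ofReal_neg, mul_neg, neg_smul]

lemma evolve_neg (H : Op V) (t : ℝ) (W : Op V) : evolve (-H) t W = evolve H (-t) W := by
  rw [evolve_eq, evolve_eq, propagator_neg, propagator_neg]

lemma propagator_mul_neg (H : Op V) (t : ℝ) : propagator H t * propagator H (-t) = 1 := by
  have comm : Commute ((Complex.I * (t : ℂ)) • H) ((Complex.I * ((-t : ℝ) : ℂ)) • H) :=
    ((Commute.refl H).smul_left _).smul_right _
  rw [propagator, propagator, ← Matrix.exp_add_of_commute _ _ comm, ← add_smul, Complex.ofReal_neg,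
    mul_neg, add_neg_cancel, zero_smul, NormedSpace.exp_zero]

lemma propagator_neg_mul (H : Op V) (t : ℝ) : propagator H (-t) * propagator H t = 1 := by
  simpa only [neg_neg] using propagator_mul_neg H (-t)

lemma propagator_add (h : Commute H A) (t : ℝ) :
    propagator (H + A) t = propagator H t * propagator A t := by
  rw [propagator, smul_add, Matrix.exp_add_of_commute _ _ ((h.smul_left _).smul_right _)]
  rfl

lemma propagator_mem_localAlgebra (hH : H ∈ localAlgebra S) (t : ℝ) :
    propagator H t ∈ localAlgebra S :=
  exp_mem_localAlgebra (SMulMemClass.smul_mem _ hH)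

lemma commute_propagator (h : Commute H A) (t : ℝ) : Commute (propagator H t) A :=
  (h.smul_left _).exp_left

lemma conjTranspose_propagator (hH : H.IsHermitian) (t : ℝ) :
    (propagator H t)ᴴ = propagator H (-t) := by
  rw [propagator, ← Matrix.exp_conjTranspose, Matrix.conjTranspose_smul, hH.eq, propagator]
  simp only [star_mul', Complex.star_def, Complex.conj_I, Complex.conj_ofReal, Complex.ofReal_neg,
    neg_mul, mul_neg]

lemma propagator_mem_unitary (hH : H.IsHermitian) (t : ℝ) : propagator H t ∈ unitary (Op V) := by
  rw [Unitary.mem_iff, Matrix.star_eq_conjTranspose, conjTranspose_propagator hH]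
  exact ⟨propagator_neg_mul H t, propagator_mul_neg H t⟩

lemma evolve_mem_localAlgebra (hH : H ∈ localAlgebra S) (hA : A ∈ localAlgebra S) (t : ℝ) :
    evolve H t A ∈ localAlgebra S := by
  rw [evolve_eq]
  exact mul_mem (mul_mem (propagator_mem_localAlgebra hH t) hA) (propagator_mem_localAlgebra hH _)

lemma leakage_evolve (hH : H ∈ localAlgebra S) (t : ℝ) (A : Op V) :
    leakage S (evolve H t A) = evolve H t (leakage S A) := by
  rw [evolve_eq, leakage_mul_of_mem_right (propagator_mem_localAlgebra hH _),
    leakage_mul_of_mem (propagator_mem_localAlgebra hH _), ← evolve_eq]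

lemma evolve_of_commute (h : Commute H A) (t : ℝ) : evolve H t A = A := by
  rw [evolve_eq, (commute_propagator h t).eq, mul_assoc, propagator_mul_neg, mul_one]

lemma evolve_add (h : Commute H A) (t : ℝ) (W : Op V) :
    evolve (H + A) t W = evolve H t (evolve A t W) := by
  simp only [evolve_eq, propagator_add h, mul_assoc]
  rw [← propagator_add h, add_comm, propagator_add h.symm]

lemma isHermitian_evolve (hH : H.IsHermitian) (hA : A.IsHermitian) (t : ℝ) :
    (evolve H t A).IsHermitian := by
  rw [Matrix.IsHermitian, evolve_eq, Matrix.conjTranspose_mul, Matrix.conjTranspose_mul, hA.eq,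
    conjTranspose_propagator hH, conjTranspose_propagator hH, neg_neg, mul_assoc]

lemma opNorm_evolve_le (hH : H.IsHermitian) (t : ℝ) (A : Op V) :
    opNorm (evolve H t A) ≤ opNorm A := by
  have norm_le_one (s : ℝ) : opNorm (propagator H s) ≤ 1 :=
    opNorm_le_one_of_mem_unitary (propagator_mem_unitary hH s)
  rw [evolve_eq]
  calc opNorm (propagator H t * A * propagator H (-t))
      ≤ opNorm (propagator H t * A) :=
        (opNorm_mul_le _ _).trans (mul_le_of_le_one_right (opNorm_nonneg _) (norm_le_one _))
    _ ≤ opNorm A :=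
        (opNorm_mul_le _ _).trans (mul_le_of_le_one_left (opNorm_nonneg _) (norm_le_one _))

lemma norm_evolve (hH : H.IsHermitian) (t : ℝ) (A : Op V) : ‖evolve H t A‖ = ‖A‖ := by
  rw [evolve_eq, frobenius_norm_mul_unitary (propagator_mem_unitary hH _),
    frobenius_norm_unitary_mul (propagator_mem_unitary hH _)]

lemma hasDerivAt_propagator (H : Op V) (t : ℝ) :
    HasDerivAt (propagator H) (propagator H t * (Complex.I • H)) t := by
  have exp_eq : propagator H = fun t : ℝ => NormedSpace.exp (t • (Complex.I • H)) := by
    funext t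
    rw [propagator, mul_comm, mul_smul, Complex.coe_smul]
  rw [exp_eq]
  exact hasDerivAt_exp_smul_const (𝕂 := ℝ) (Complex.I • H) t

lemma hasDerivAt_propagator_neg (H : Op V) (t : ℝ) :
    HasDerivAt (fun t => propagator H (-t)) (-((Complex.I • H) * propagator H (-t))) t := by
  rw [← funext (propagator_neg H), ← propagator_neg, ← neg_mul, ← smul_neg,
    ← (commute_propagator ((Commute.refl (-H)).smul_right Complex.I) t).eq]
  exact hasDerivAt_propagator (-H) t

lemma hasDerivAt_evolve_comp (H : Op V) {f : ℝ → Op V} {f' : Op V} {t : ℝ}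
    (hf : HasDerivAt f f' t) :
    HasDerivAt (fun s => evolve H s (f s))
      (evolve H t (f' + Complex.I • (H * f t - f t * H))) t := by
  have h := ((hasDerivAt_propagator H t).mul hf).mul (hasDerivAt_propagator_neg H t)
  simp only [evolve_eq]
  refine h.congr_deriv ?_
  simp only [Pi.mul_apply, mul_neg, Matrix.smul_mul, Matrix.mul_smul, smul_sub,
    mul_assoc, mul_add, add_mul, mul_sub, sub_mul]
  abel

lemma hasDerivAt_evolve (H A : Op V) (t : ℝ) :
    HasDerivAt (fun s => evolve H s A) (Complex.I • (H * evolve H t A - evolve H t A * H)) t := by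
  have comm : Commute (propagator H t) H := commute_propagator (Commute.refl H) t
  have comm_neg : Commute (propagator H (-t)) H := commute_propagator (Commute.refl H) (-t)
  refine (hasDerivAt_evolve_comp H (hasDerivAt_const t A)).congr_deriv ?_
  simp only [evolve_eq, zero_add, Matrix.mul_smul, Matrix.smul_mul, mul_sub, sub_mul]
  rw [← mul_assoc (propagator H t) H, comm.eq, ← mul_assoc (propagator H t) A H, mul_assoc _ H,
    ← comm_neg.eq]
  simp only [mul_assoc]

lemma hasDerivAt_rotated_evolve (H H₀ A : Op V) (t : ℝ) :
    HasDerivAt (fun s => evolve H₀ (-s) (evolve H s A))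
      (evolve H₀ (-t) (Complex.I • ((H - H₀) * evolve H t A - evolve H t A * (H - H₀)))) t := by
  simp only [← evolve_neg]
  refine (hasDerivAt_evolve_comp (-H₀) (hasDerivAt_evolve H A t)).congr_deriv ?_
  rw [← smul_add]
  congr 2
  noncomm_ring

end Propagator

section LiebRobinson

open scoped Matrix.Norms.Frobenius

lemma norm_le_mul_exp_of_norm_deriv_le {ι E : Type*} [Finite ι] [NormedAddCommGroup E]
    [NormedSpace ℝ E] {f f' : ι → ℝ → E} {w : ι → ℝ} {a c t : ℝ} (hw : ∀ i, 0 < w i)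
    (hf : ∀ i s, HasDerivAt (f i) (f' i s) s) (h0 : ∀ i, ‖f i 0‖ ≤ a * w i)
    (hf' : ∀ s M, (∀ i, ‖f i s‖ ≤ M * w i) → ∀ i, ‖f' i s‖ ≤ c * M * w i) (ht : 0 ≤ t) (i : ι) :
    ‖f i t‖ ≤ a * w i * Real.exp (c * t) := by
  cases nonempty_fintype ι
  have : Nonempty ι := ⟨i⟩
  let weighted (g : ι → ℝ → E) (s : ℝ) : ι → E := fun i => (w i)⁻¹ • g i s
  have weighted_le_iff (g : ι → ℝ → E) (s M : ℝ) :
      ‖weighted g s‖ ≤ M ↔ ∀ i, ‖g i s‖ ≤ M * w i := by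
    refine (pi_norm_le_iff_of_nonempty _).trans (forall_congr' fun i => ?_)
    rw [norm_smul, Real.norm_of_nonneg (inv_nonneg.2 (hw i).le), inv_mul_eq_div, div_le_iff₀ (hw i)]
  have hasDerivAt_weighted (s : ℝ) : HasDerivAt (weighted f) (weighted f' s) s :=
    hasDerivAt_pi.2 fun i => (hf i s).const_smul _
  have gronwall := norm_le_gronwallBound_of_norm_deriv_right_le (ε := 0)
    (fun s _ => (hasDerivAt_weighted s).continuousAt.continuousWithinAt)
    (fun s _ => (hasDerivAt_weighted s).hasDerivWithinAt) ((weighted_le_iff f 0 a).2 h0)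
    (fun s _ => (weighted_le_iff f' s _).2 fun i => by
      simpa only [add_zero] using hf' s _ ((weighted_le_iff f s _).1 le_rfl) i) t ⟨ht, le_rfl⟩
  rw [gronwallBound_ε0, sub_zero, weighted_le_iff] at gronwall
  exact (gronwall i).trans_eq (mul_right_comm _ _ _)

variable {V : Type*} [Fintype V] [DecidableEq V] {𝒵 : Finset (Finset V)} {h : Finset V → Op V}
  {K : V → V → ℝ} {J lam : ℝ}

lemma norm_sum_commutator_le (hmem : ∀ Z ∈ 𝒵, h Z ∈ localAlgebra Z) (A : Op V) (j : V) :
    ‖(∑ Z ∈ 𝒵 with j ∈ Z, h Z) * A - A * ∑ Z ∈ 𝒵 with j ∈ Z, h Z‖ ≤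
      2 * ∑ l, ‖sitePart l A‖ * ∑ Z ∈ 𝒵 with l ∈ Z ∧ j ∈ Z, opNorm (h Z) := by
  rw [Finset.sum_mul, Finset.mul_sum, ← Finset.sum_sub_distrib]
  calc ‖∑ Z ∈ 𝒵 with j ∈ Z, (h Z * A - A * h Z)‖
      ≤ ∑ Z ∈ 𝒵 with j ∈ Z, 2 * opNorm (h Z) * ∑ l ∈ Z, ‖sitePart l A‖ :=
        norm_sum_le_of_le _ fun Z hZ => norm_commutator_le (hmem Z (Finset.mem_filter.1 hZ).1) A
    _ = ∑ Z ∈ 𝒵 with j ∈ Z, ∑ l ∈ Z, 2 * (‖sitePart l A‖ * opNorm (h Z)) := by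
        simp only [Finset.mul_sum]
        exact Finset.sum_congr rfl fun Z _ => Finset.sum_congr rfl fun l _ => by ring
    _ = 2 * ∑ l, ‖sitePart l A‖ * ∑ Z ∈ 𝒵 with l ∈ Z ∧ j ∈ Z, opNorm (h Z) := by
        simp only [Finset.mul_sum]
        exact Finset.sum_comm' fun Z l => by simp only [Finset.mem_filter, Finset.mem_univ]; tauto

lemma norm_sum_commutator_le_of_sitePart_le (hmem : ∀ Z ∈ 𝒵, h Z ∈ localAlgebra Z)
    (hK : ∀ i j, 0 < K i j)
    (hdecay : ∀ i j, ∑ Z ∈ 𝒵 with i ∈ Z ∧ j ∈ Z, opNorm (h Z) ≤ J * K i j)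
    (hconv : ∀ i j, ∑ l, K i l * K l j ≤ lam * K i j) {A : Op V} {i : V} {M : ℝ}
    (hA : ∀ l, ‖sitePart l A‖ ≤ M * K i l) (j : V) :
    ‖(∑ Z ∈ 𝒵 with j ∈ Z, h Z) * A - A * ∑ Z ∈ 𝒵 with j ∈ Z, h Z‖ ≤
      2 * J * lam * M * K i j := by
  have hM : 0 ≤ M := nonneg_of_mul_nonneg_left ((norm_nonneg _).trans (hA j)) (hK i j)
  have sum_nonneg (l : V) : 0 ≤ ∑ Z ∈ 𝒵 with l ∈ Z ∧ j ∈ Z, opNorm (h Z) :=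
    Finset.sum_nonneg fun Z _ => opNorm_nonneg _
  have hJ : 0 ≤ J := nonneg_of_mul_nonneg_left ((sum_nonneg j).trans (hdecay j j)) (hK j j)
  calc _ ≤ 2 * ∑ l, ‖sitePart l A‖ * ∑ Z ∈ 𝒵 with l ∈ Z ∧ j ∈ Z, opNorm (h Z) :=
        norm_sum_commutator_le hmem A j
    _ ≤ 2 * ∑ l, (M * K i l) * (J * K l j) := by
        gcongr with l
        · exact sum_nonneg l
        · exact mul_nonneg hM (hK i l).le
        · exact hA l
        · exact hdecay l j
    _ = 2 * J * M * ∑ l, K i l * K l j := by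
        simp only [Finset.mul_sum]
        exact Finset.sum_congr rfl fun l _ => by ring
    _ ≤ 2 * J * M * (lam * K i j) := by
        gcongr
        exact hconv i j
    _ = 2 * J * lam * M * K i j := by ring

lemma hasDerivAt_sitePart {f : ℝ → Op V} {f' : Op V} {t : ℝ} (hf : HasDerivAt f f' t) (j : V) :
    HasDerivAt (fun s => sitePart j (f s)) (sitePart j f') t :=
  ((sitePart j).toContinuousLinearMap.restrictScalars ℝ).hasFDerivAt.comp_hasDerivAt t hf

theorem norm_sitePart_evolve_le (hmem : ∀ Z ∈ 𝒵, h Z ∈ localAlgebra Z)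
    (hherm : ∀ Z ∈ 𝒵, (h Z).IsHermitian) (hK : ∀ i j, 0 < K i j)
    (hdecay : ∀ i j, ∑ Z ∈ 𝒵 with i ∈ Z ∧ j ∈ Z, opNorm (h Z) ≤ J * K i j)
    (hconv : ∀ i j, ∑ l, K i l * K l j ≤ lam * K i j) {A : Op V} {i : V} {a : ℝ}
    (hA : ∀ j, ‖sitePart j A‖ ≤ a * K i j) {t : ℝ} (ht : 0 ≤ t) (j : V) :
    ‖sitePart j (evolve (∑ Z ∈ 𝒵, h Z) t A)‖ ≤ a * K i j * Real.exp (2 * J * lam * t) := by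
  set H : Op V := ∑ Z ∈ 𝒵, h Z
  -- The terms not touching `j` commute with taking the part at `j`; rotating with them leaves
  -- its norm unchanged and removes them from the generator.
  let Hₒ (j : V) : Op V := ∑ Z ∈ 𝒵 with j ∉ Z, h Z
  let Hⱼ (j : V) : Op V := ∑ Z ∈ 𝒵 with j ∈ Z, h Z
  have sub_eq (j : V) : H - Hₒ j = Hⱼ j :=
    sub_eq_iff_eq_add.2 (Finset.sum_filter_add_sum_filter_not _ _ _).symm
  have mem_localAlgebra (j : V) : Hₒ j ∈ localAlgebra {j}ᶜ := sum_mem fun Z hZ =>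
    localAlgebra_mono (subset_compl_singleton.2 (Finset.mem_filter.1 hZ).2)
      (hmem Z (Finset.mem_filter.1 hZ).1)
  have isHermitian (j : V) : (Hₒ j).IsHermitian := isSelfAdjoint_sum _ fun Z hZ =>
    hherm Z (Finset.mem_filter.1 hZ).1
  have sitePart_rotated (s : ℝ) (B : Op V) (j : V) :
      ‖sitePart j (evolve (Hₒ j) (-s) B)‖ = ‖sitePart j B‖ := by
    rw [sitePart, leakage_evolve (mem_localAlgebra j), norm_evolve (isHermitian j)]
  rw [← sitePart_rotated t]
  refine norm_le_mul_exp_of_norm_deriv_le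
    (f := fun j s => sitePart j (evolve (Hₒ j) (-s) (evolve H s A))) (hK i)
    (fun j s => hasDerivAt_sitePart (hasDerivAt_rotated_evolve H (Hₒ j) A s) j) ?_ ?_ ht j
  · simpa only [neg_zero, evolve_zero] using hA
  · intro s M hM j
    simp only [sitePart_rotated, sub_eq] at hM ⊢
    calc _ ≤ ‖Complex.I • (Hⱼ j * evolve H s A - evolve H s A * Hⱼ j)‖ := norm_leakage_le _ _
      _ = ‖Hⱼ j * evolve H s A - evolve H s A * Hⱼ j‖ := by
          rw [norm_smul, Complex.norm_I, one_mul]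
      _ ≤ 2 * J * lam * M * K i j :=
          norm_sum_commutator_le_of_sitePart_le hmem hK hdecay hconv hM j

end LiebRobinson

section InteractionPicture

open scoped Matrix.Norms.Frobenius Topology

variable {V : Type*} [Fintype V] [DecidableEq V] {R Y : Finset V}

/-- The unitary operators acting on the spins in `S`. -/
def localUnitaries (S : Finset V) : Submonoid (Op V) :=
  unitary (Op V) ⊓ (localAlgebra S).toSubmonoid

lemma mem_localUnitaries {U : Op V} :
    U ∈ localUnitaries R ↔ U ∈ unitary (Op V) ∧ U ∈ localAlgebra R := Iff.rfl

lemma infDist_localUnitaries_le {E : Op V} (hE : E ∈ localUnitaries R) (U U' : Op V) :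
    Metric.infDist U' (localUnitaries R) ≤ Metric.infDist U (localUnitaries R) + ‖U' - U * E‖ := by
  rw [← sub_le_iff_le_add, Metric.le_infDist ⟨1, one_mem (localUnitaries R)⟩]
  intro u hu
  rw [sub_le_iff_le_add']
  calc Metric.infDist U' (localUnitaries R) ≤ ‖U' - u * E‖ :=
        (Metric.infDist_le_dist_of_mem (mul_mem hu hE)).trans_eq (dist_eq_norm _ _)
    _ ≤ ‖U' - U * E‖ + ‖U * E - u * E‖ := norm_sub_le_norm_sub_add_norm_sub _ _ _
    _ = ‖U' - U * E‖ + dist U u := by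
        rw [← sub_mul, frobenius_norm_mul_unitary (mem_localUnitaries.1 hE).1, dist_eq_norm]

lemma frequently_slope_infDist_localUnitaries_lt {U : ℝ → Op V} {T : Op V} {x r : ℝ}
    (hU : HasDerivAt U (U x * (Complex.I • T)) x) (hUx : U x ∈ unitary (Op V))
    (hT : T.IsHermitian) (hr : ‖leakage R T‖ < r) :
    ∃ᶠ z in 𝓝[>] x, slope (fun s => Metric.infDist (U s) (localUnitaries R)) x z < r := by
  set T' : Op V := localApproxₗ R T
  have hT' : T'.IsHermitian := by
    rw [Matrix.IsHermitian, ← localApproxₗ_conjTranspose, hT.eq]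
  have mem_localUnitaries (s : ℝ) : propagator T' s ∈ localUnitaries R :=
    ⟨propagator_mem_unitary hT' s, propagator_mem_localAlgebra (localApproxₗ_mem R T) s⟩
  have hasDerivAt_sub :
      HasDerivAt (fun z => U z - U x * propagator T' (z - x))
        (U x * (Complex.I • leakage R T)) x := by
    have h := hasDerivAt_propagator T' (x - x)
    rw [sub_self, propagator_zero, one_mul, ← sub_self x] at h
    refine (hU.sub ((h.comp_sub_const x x).const_mul (U x))).congr_deriv ?_
    rw [leakage_apply, smul_sub, mul_sub]
  have norm_deriv : ‖U x * (Complex.I • leakage R T)‖ = ‖leakage R T‖ := by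
    rw [frobenius_norm_unitary_mul hUx, norm_smul, Complex.norm_I, one_mul]
  refine (hasDerivAt_sub.hasDerivWithinAt.liminf_right_slope_norm_le (norm_deriv.trans_lt hr)).mp ?_
  filter_upwards [self_mem_nhdsWithin] with z hz slope_lt
  rw [sub_self, propagator_zero, mul_one, sub_self, norm_zero, sub_zero] at slope_lt
  rw [slope_def_field, div_eq_inv_mul]
  refine lt_of_le_of_lt ?_ slope_lt
  have : 0 < z - x := sub_pos.2 hz
  gcongr
  rw [sub_le_iff_le_add']
  exact infDist_localUnitaries_le (mem_localUnitaries _) (U x) (U z)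

lemma infDist_localUnitaries_le_mul {U T : ℝ → Op V} {t η : ℝ}
    (hU : ∀ s, HasDerivAt U (U s * (Complex.I • T s)) s) (hU' : ∀ s, U s ∈ unitary (Op V))
    (hU0 : U 0 = 1) (hT : ∀ s, (T s).IsHermitian) (ht : 0 ≤ t)
    (hη : ∀ s ∈ Set.Icc 0 t, ‖leakage R (T s)‖ ≤ η) :
    Metric.infDist (U t) (localUnitaries R) ≤ η * t := by
  refine image_le_of_liminf_slope_right_le_deriv_boundary
    (f := fun s => Metric.infDist (U s) (localUnitaries R)) (a := 0) (b := t) (B := fun s => η * s)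
    (B' := fun _ => η) (fun s _ => ?_) ?_ (by fun_prop) (fun s _ => ?_) (fun s hs r hr => ?_)
    ⟨ht, le_rfl⟩
  · exact ((Metric.continuous_infDist_pt _).continuousAt.comp
      (hU s).continuousAt).continuousWithinAt
  · rw [mul_zero, hU0, Metric.infDist_zero_of_mem (one_mem (localUnitaries R))]
  · simpa only [id_eq, mul_one] using ((hasDerivAt_id s).const_mul η).hasDerivWithinAt
  · exact frequently_slope_infDist_localUnitaries_lt (hU s) (hU' s) (hT s)
      ((hη s ⟨hs.1, hs.2.le⟩).trans_lt hr)

lemma norm_leakage_conj_le {U W : Op V} (hU : U ∈ unitary (Op V)) (hW : W ∈ localAlgebra R) :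
    ‖leakage R (U * W * Uᴴ)‖ ≤ 2 * opNorm W * Metric.infDist U (localUnitaries R) := by
  rw [Metric.infDist_eq_iInf, Real.mul_iInf_of_nonneg
    (mul_nonneg zero_le_two (opNorm_nonneg W))]
  have : Nonempty (localUnitaries R) := ⟨1⟩
  refine le_ciInf fun ⟨u, hu⟩ => ?_
  obtain ⟨hu_unitary, hu_local⟩ := mem_localUnitaries.1 hu
  have conj_mem : u * W * uᴴ ∈ localAlgebra R :=
    mul_mem (mul_mem hu_local hW) (star_mem hu_local)
  have hU_star : Uᴴ ∈ unitary (Op V) := Unitary.star_mem hU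
  calc ‖leakage R (U * W * Uᴴ)‖ ≤ ‖U * W * Uᴴ - u * W * uᴴ‖ := norm_leakage_le_norm_sub conj_mem _
    _ = ‖(U - u) * W * Uᴴ + u * (W * (U - u)ᴴ)‖ := by
        congr 1
        simp only [Matrix.conjTranspose_sub, sub_mul, mul_sub, mul_assoc]
        abel
    _ ≤ ‖(U - u) * W * Uᴴ‖ + ‖u * (W * (U - u)ᴴ)‖ := norm_add_le _ _
    _ = ‖(U - u) * W‖ + ‖W * (U - u)ᴴ‖ := by
        rw [frobenius_norm_mul_unitary hU_star, frobenius_norm_unitary_mul hu_unitary]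
    _ ≤ ‖U - u‖ * opNorm W + opNorm W * ‖(U - u)ᴴ‖ :=
        add_le_add (norm_mul_le_mul_opNorm _ _) (norm_mul_le_opNorm_mul _ _)
    _ = 2 * opNorm W * dist U u := by
        rw [Matrix.frobenius_norm_conjTranspose, dist_eq_norm]
        ring

/-- The propagator of `H` in the interaction picture with respect to `H₀`. -/
def interactionPropagator (H H₀ : Op V) (t : ℝ) : Op V := propagator H t * propagator H₀ (-t)

lemma interactionPropagator_mem_unitary {H H₀ : Op V} (hH : H.IsHermitian) (hH₀ : H₀.IsHermitian)
    (t : ℝ) : interactionPropagator H H₀ t ∈ unitary (Op V) :=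
  mul_mem (propagator_mem_unitary hH t) (propagator_mem_unitary hH₀ (-t))

lemma hasDerivAt_interactionPropagator (H H₀ : Op V) (t : ℝ) :
    HasDerivAt (interactionPropagator H H₀)
      (interactionPropagator H H₀ t * (Complex.I • evolve H₀ t (H - H₀))) t := by
  refine ((hasDerivAt_propagator H t).mul (hasDerivAt_propagator_neg H₀ t)).congr_deriv ?_
  have cancel (M : Op V) : propagator H₀ (-t) * (propagator H₀ t * M) = M := by
    rw [← mul_assoc, propagator_neg_mul, one_mul]
  simp only [interactionPropagator, evolve_eq, Matrix.mul_smul, Matrix.smul_mul, mul_assoc, cancel,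
    mul_neg, sub_mul, mul_sub, smul_sub]
  abel

lemma evolve_eq_interactionPropagator {H H₀ : Op V} (hH : H.IsHermitian) (hH₀ : H₀.IsHermitian)
    (t : ℝ) (W : Op V) :
    evolve H t W =
      interactionPropagator H H₀ t * evolve H₀ t W * (interactionPropagator H H₀ t)ᴴ := by
  have cancel (M : Op V) : propagator H₀ (-t) * (propagator H₀ t * M) = M := by
    rw [← mul_assoc, propagator_neg_mul, one_mul]
  rw [interactionPropagator, Matrix.conjTranspose_mul, conjTranspose_propagator hH,
    conjTranspose_propagator hH₀, neg_neg, evolve_eq, evolve_eq]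
  simp only [mul_assoc, cancel]

/-- Only the leakage of `T` under `B` matters: `A` commutes with `B` and acts inside `R`, and
without `T` the operator `W` would never leave `Y`. -/
theorem norm_leakage_evolve_le (hYR : Y ⊆ R) {A B T W : Op V} (hA : A.IsHermitian)
    (hB : B.IsHermitian) (hT : T.IsHermitian) (hAY : A ∈ localAlgebra Y)
    (hBY : B ∈ localAlgebra Yᶜ) (hW : W ∈ localAlgebra Y) {t η : ℝ} (ht : 0 ≤ t)
    (hη : ∀ s ∈ Set.Icc 0 t, ‖leakage R (evolve B s T)‖ ≤ η) :
    ‖leakage R (evolve (A + B + T) t W)‖ ≤ 2 * opNorm W * (η * t) := by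
  have hAB : (A + B).IsHermitian := hA.add hB
  have hABT : (A + B + T).IsHermitian := hAB.add hT
  have commAB : Commute A B := commute_of_disjoint hAY hBY disjoint_compl_right
  have commBW : Commute B W := (commute_of_disjoint hW hBY disjoint_compl_right).symm
  have evolve_W : evolve (A + B) t W = evolve A t W := by
    rw [evolve_add commAB, evolve_of_commute commBW]
  have norm_leakage_T (s : ℝ) :
      ‖leakage R (evolve (A + B) s (A + B + T - (A + B)))‖ = ‖leakage R (evolve B s T)‖ := by
    rw [add_sub_cancel_left, evolve_add commAB, leakage_evolve (localAlgebra_mono hYR hAY),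
      norm_evolve hA]
  have infDist_le : Metric.infDist (interactionPropagator (A + B + T) (A + B) t)
      (localUnitaries R) ≤ η * t :=
    infDist_localUnitaries_le_mul (hasDerivAt_interactionPropagator _ _)
      (interactionPropagator_mem_unitary hABT hAB)
      (by rw [interactionPropagator, neg_zero, propagator_zero, propagator_zero, one_mul])
      (fun s => isHermitian_evolve hAB (hABT.sub hAB) s) ht
      (fun s hs => (norm_leakage_T s).trans_le (hη s hs))
  rw [evolve_eq_interactionPropagator hABT hAB, evolve_W]
  refine (norm_leakage_conj_le (interactionPropagator_mem_unitary hABT hAB t)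
    (localAlgebra_mono hYR (evolve_mem_localAlgebra hAY hW t))).trans ?_
  exact mul_le_mul (mul_le_mul_of_nonneg_left (opNorm_evolve_le hA t W) zero_le_two) infDist_le
    Metric.infDist_nonneg (mul_nonneg zero_le_two (opNorm_nonneg W))

end InteractionPicture

section Hamiltonian

open scoped Matrix.Norms.Frobenius

variable {V : Type*} [Fintype V] [DecidableEq V] {R Y : Finset V}

lemma pauliCoeff_term (c : (V → Fin 4) → ℝ) (Z : Finset V) (p : V → Fin 4) :
    pauliCoeff p (term c Z) = if supp p = Z then (c p : ℂ) else 0 := by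
  simp only [term, map_sum, map_smul, pauliCoeff_pauliString, smul_eq_mul, mul_ite, mul_one,
    mul_zero, Finset.sum_ite_eq, Finset.mem_filter, Finset.mem_univ, true_and]

lemma term_mem_localAlgebra (c : (V → Fin 4) → ℝ) (Z : Finset V) : term c Z ∈ localAlgebra Z := by
  refine mem_localAlgebra_iff_pauliCoeff.2 fun p hp => ?_
  rw [pauliCoeff_term, if_neg (mt Eq.subset hp)]

lemma sum_term_mem_localAlgebra (c : (V → Fin 4) → ℝ) {𝒵 : Finset (Finset V)} {S : Finset V}
    (h𝒵 : 𝒵 ⊆ S.powerset) : ∑ Z ∈ 𝒵, term c Z ∈ localAlgebra S :=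
  sum_mem fun Z hZ => localAlgebra_mono (Finset.mem_powerset.1 (h𝒵 hZ)) (term_mem_localAlgebra c Z)

lemma isHermitian_sum_term (c : (V → Fin 4) → ℝ) (𝒵 : Finset (Finset V)) :
    (∑ Z ∈ 𝒵, term c Z).IsHermitian :=
  isSelfAdjoint_sum _ fun _ _ => isSelfAdjoint_sum _ fun p _ =>
    IsSelfAdjoint.smul (Complex.conj_ofReal (c p)) (isHermitian_pauliString p)

lemma term_neg (c : (V → Fin 4) → ℝ) (Z : Finset V) : term (-c) Z = -term c Z := by
  simp only [term, Pi.neg_apply, Complex.ofReal_neg, neg_smul, Finset.sum_neg_distrib]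

lemma hamiltonian_neg (c : (V → Fin 4) → ℝ) : hamiltonian (-c) = -hamiltonian c := by
  simp only [hamiltonian, term_neg, Finset.sum_neg_distrib]

/-- The sets of sites meeting both `Y` and its complement, which carry the interaction terms that
transport operators out of `Y`. -/
def crossing (Y : Finset V) : Finset (Finset V) := (Y.powerset ∪ Yᶜ.powerset)ᶜ

lemma hamiltonian_eq_add_crossing (c : (V → Fin 4) → ℝ) (Y : Finset V) :
    hamiltonian c = ∑ Z ∈ Y.powerset, term c Z + ∑ Z ∈ Yᶜ.powerset \ Y.powerset, term c Z +
      ∑ Z ∈ crossing Y, term c Z := by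
  rw [← Finset.sum_union Finset.disjoint_sdiff, Finset.union_sdiff_self_eq_union, crossing,
    Finset.sum_add_sum_compl, hamiltonian]

lemma leakage_compl_sum_crossing (c : (V → Fin 4) → ℝ) (Y : Finset V) :
    leakage Yᶜ (∑ Z ∈ crossing Y, term c Z) = ∑ Z ∈ crossing Y, term c Z := by
  refine ext_pauliCoeff fun p => ?_
  rw [pauliCoeff_leakage, map_sum]
  refine ite_eq_right_iff.2 fun hp => (Finset.sum_eq_zero fun Z hZ => ?_).symm
  rw [pauliCoeff_term, if_neg]
  rintro rfl
  exact Finset.mem_compl.1 hZ (Finset.mem_union_right _ (Finset.mem_powerset.2 hp))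

lemma norm_sitePart_sitePart_sum_le {𝒵 : Finset (Finset V)} {h : Finset V → Op V}
    (hmem : ∀ Z ∈ 𝒵, h Z ∈ localAlgebra Z) (i j : V) :
    ‖sitePart j (sitePart i (∑ Z ∈ 𝒵, h Z))‖ ≤
      (∑ Z ∈ 𝒵 with i ∈ Z ∧ j ∈ Z, opNorm (h Z)) * √(2 ^ Fintype.card V) := by
  rw [map_sum, map_sum, Finset.sum_mul, Finset.sum_filter]
  refine norm_sum_le_of_le _ fun Z hZ => ?_
  split_ifs with hij
  · exact (norm_leakage_le _ _).trans ((norm_leakage_le _ _).trans (norm_le_opNorm _))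
  · refine (norm_eq_zero.2 ?_).le
    rcases not_and_or.1 hij with hi | hj
    · rw [sitePart_eq_zero (hmem Z hZ) hi, map_zero]
    · rw [sitePart, sitePart, leakage_comm, ← sitePart, ← sitePart,
        sitePart_eq_zero (hmem Z hZ) hj, map_zero]

variable {c : (V → Fin 4) → ℝ} {K : V → V → ℝ} {J lam : ℝ}

lemma norm_sitePart_sitePart_evolve_crossing_le (hK : ∀ i j, 0 < K i j)
    (hdecay : ∀ i j, ∑ Z : Finset V with i ∈ Z ∧ j ∈ Z, opNorm (term c Z) ≤ J * K i j)
    (hconv : ∀ i j, ∑ l, K i l * K l j ≤ lam * K i j) {s : ℝ} (hs : 0 ≤ s) {i : V} (hi : i ∈ Y)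
    (j : V) :
    ‖sitePart j (sitePart i
        (evolve (∑ Z ∈ Yᶜ.powerset \ Y.powerset, term c Z) s (∑ Z ∈ crossing Y, term c Z)))‖ ≤
      J * √(2 ^ Fintype.card V) * K i j * Real.exp (2 * J * lam * s) := by
  have decay (𝒵 : Finset (Finset V)) (i j : V) :
      ∑ Z ∈ 𝒵 with i ∈ Z ∧ j ∈ Z, opNorm (term c Z) ≤ J * K i j :=
    (Finset.sum_le_sum_of_subset_of_nonneg (Finset.filter_subset_filter _ (Finset.subset_univ 𝒵))
      fun Z _ _ => opNorm_nonneg _).trans (hdecay i j)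
  have compl_subset : Yᶜ ⊆ {i}ᶜ := Finset.compl_subset_compl.2 (Finset.singleton_subset_iff.2 hi)
  rw [sitePart, sitePart, leakage_evolve (localAlgebra_mono compl_subset
    (sum_term_mem_localAlgebra c Finset.sdiff_subset)), ← sitePart, ← sitePart]
  refine norm_sitePart_evolve_le (fun Z _ => term_mem_localAlgebra c Z)
    (fun Z _ => by simpa only [Finset.sum_singleton] using isHermitian_sum_term c {Z}) hK (decay _)
    hconv (fun l => ?_) hs j
  refine (norm_sitePart_sitePart_sum_le (fun Z _ => term_mem_localAlgebra c Z) i l).trans ?_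
  rw [mul_right_comm J]
  gcongr
  exact decay _ i l

lemma norm_leakage_evolve_crossing_le (hK : ∀ i j, 0 < K i j) (hJ : 0 ≤ J)
    (hdecay : ∀ i j, ∑ Z : Finset V with i ∈ Z ∧ j ∈ Z, opNorm (term c Z) ≤ J * K i j)
    (hconv : ∀ i j, ∑ l, K i l * K l j ≤ lam * K i j) (Y R : Finset V) {s : ℝ} (hs : 0 ≤ s) :
    ‖leakage R
        (evolve (∑ Z ∈ Yᶜ.powerset \ Y.powerset, term c Z) s (∑ Z ∈ crossing Y, term c Z))‖ ≤
      J * √(2 ^ Fintype.card V) * Real.exp (2 * J * lam * s) *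
        √(∑ i ∈ Y, ∑ j ∈ Rᶜ, K i j ^ 2) := by
  rw [← leakage_compl_sum_crossing,
    ← leakage_evolve (sum_term_mem_localAlgebra c Finset.sdiff_subset)]
  refine le_of_sq_le_sq ((norm_leakage_leakage_sq_le _ _ _).trans ?_) (by positivity)
  rw [compl_compl, mul_pow, Real.sq_sqrt (by positivity), Finset.mul_sum]
  refine Finset.sum_le_sum fun i hi => ?_
  rw [Finset.mul_sum]
  refine Finset.sum_le_sum fun j _ => ?_
  rw [← mul_pow, mul_right_comm]
  gcongr
  exact norm_sitePart_sitePart_evolve_crossing_le hK hdecay hconv hs hi j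

lemma norm_leakage_evolve_hamiltonian_le (hK : ∀ i j, 0 < K i j) (hJ : 0 ≤ J) (hlam : 0 ≤ lam)
    (hdecay : ∀ i j, ∑ Z : Finset V with i ∈ Z ∧ j ∈ Z, opNorm (term c Z) ≤ J * K i j)
    (hconv : ∀ i j, ∑ l, K i l * K l j ≤ lam * K i j) (hYR : Y ⊆ R) {W : Op V}
    (hW : W ∈ localAlgebra Y) {t : ℝ} (ht : 0 ≤ t) :
    ‖leakage R (evolve (hamiltonian c) t W)‖ ≤
      2 * opNorm W * (J * √(2 ^ Fintype.card V) * Real.exp (2 * J * lam * t) *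
        √(∑ i ∈ Y, ∑ j ∈ Rᶜ, K i j ^ 2) * t) := by
  rw [hamiltonian_eq_add_crossing c Y]
  refine norm_leakage_evolve_le hYR (isHermitian_sum_term c _) (isHermitian_sum_term c _)
    (isHermitian_sum_term c _) (sum_term_mem_localAlgebra c subset_rfl)
    (sum_term_mem_localAlgebra c Finset.sdiff_subset) hW ht fun s hs => ?_
  refine (norm_leakage_evolve_crossing_le hK hJ hdecay hconv Y R hs.1).trans ?_
  gcongr
  exact hs.2

theorem frobNorm_leakage_evolve_hamiltonian_le (hK : ∀ i j, 0 < K i j) (hJ : 0 ≤ J)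
    (hlam : 0 ≤ lam)
    (hdecay : ∀ i j, ∑ Z : Finset V with i ∈ Z ∧ j ∈ Z, opNorm (term c Z) ≤ J * K i j)
    (hconv : ∀ i j, ∑ l, K i l * K l j ≤ lam * K i j) (hYR : Y ⊆ R) {W : Op V}
    (hW : W ∈ localAlgebra Y) (t : ℝ) :
    frobNorm (leakage R (evolve (hamiltonian c) t W)) ≤
      2 * J * Real.exp (2 * J * lam * |t|) * |t| * opNorm W *
        √(∑ i ∈ Y, ∑ j ∈ Rᶜ, K i j ^ 2) := by
  have norm_le : ‖leakage R (evolve (hamiltonian c) t W)‖ ≤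
      2 * opNorm W * (J * √(2 ^ Fintype.card V) * Real.exp (2 * J * lam * |t|) *
        √(∑ i ∈ Y, ∑ j ∈ Rᶜ, K i j ^ 2) * |t|) := by
    rcases le_total 0 t with ht | ht
    · rw [abs_of_nonneg ht]
      exact norm_leakage_evolve_hamiltonian_le hK hJ hlam hdecay hconv hYR hW ht
    · have decay_neg (i j : V) :
          ∑ Z : Finset V with i ∈ Z ∧ j ∈ Z, opNorm (term (-c) Z) ≤ J * K i j := by
        simpa only [term_neg, opNorm_neg] using hdecay i j
      rw [abs_of_nonpos ht, ← neg_neg (hamiltonian c), evolve_neg, ← hamiltonian_neg]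
      exact norm_leakage_evolve_hamiltonian_le hK hJ hlam decay_neg hconv hYR hW
        (neg_nonneg.2 ht)
  rw [frobNorm_eq, div_le_iff₀ (by positivity)]
  exact norm_le.trans_eq (by ring)

end Hamiltonian

section Distance

variable {V : Type*} {G : SimpleGraph V} {i j : V}

lemma dist_getVert_le (w : G.Walk i j) (n : ℕ) : G.dist i (w.getVert n) ≤ n :=
  (SimpleGraph.dist_le (w.take n)).trans ((w.take_length n).trans_le (min_le_left _ _))

lemma dist_getVert_le_length_sub (w : G.Walk i j) (n : ℕ) :
    G.dist (w.getVert n) j ≤ w.length - n :=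
  (SimpleGraph.dist_le (w.drop n)).trans_eq (w.drop_length n)

lemma dist_add_dist_getVert_of_length_eq_dist {w : G.Walk i j} (hw : w.length = G.dist i j)
    (n : ℕ) : G.dist i (w.getVert n) + G.dist (w.getVert n) j = G.dist i j := by
  refine le_antisymm ?_ ((w.take n).reachable.dist_triangle_left j)
  rcases le_total n w.length with hn | hn
  · have := dist_getVert_le w n
    have := dist_getVert_le_length_sub w n
    omega
  · rw [w.getVert_of_length_le hn, SimpleGraph.dist_self, add_zero]

lemma exists_getVert_mem_getVert_succ_notMem (w : G.Walk i j) {S : Set V} (hi : i ∈ S)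
    (hj : j ∉ S) : ∃ n < w.length, w.getVert n ∈ S ∧ w.getVert (n + 1) ∉ S := by
  by_contra! stay
  have mem_of_le (n : ℕ) (hn : n ≤ w.length) : w.getVert n ∈ S := by
    induction n with
    | zero => rwa [w.getVert_zero]
    | succ n ih => exact stay n hn (ih (Nat.le_of_succ_le hn))
  exact hj (w.getVert_length ▸ mem_of_le _ le_rfl)

variable {X : Finset V} {n : ℕ}

lemma distTo_le_iff (hG : G.Connected) : distTo G i X ≤ n ↔ ∃ x ∈ X, G.dist i x ≤ n := by
  constructor
  · intro hle
    by_contra! hlt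
    have succ_le : ((n + 1 : ℕ) : ℕ∞) ≤ distTo G i X := le_iInf₂ fun x hx => by
      rw [← (hG i x).coe_dist_eq_edist]
      exact_mod_cast hlt x hx
    exact (Nat.lt_succ_self n).not_ge (by exact_mod_cast succ_le.trans hle)
  · rintro ⟨x, hx, hle⟩
    refine (iInf₂_le x hx).trans ?_
    rw [← (hG i x).coe_dist_eq_edist]
    exact_mod_cast hle

lemma distTo_eq_of_forall_le (hG : G.Connected) {x : V} (hx : x ∈ X) (hle : G.dist i x ≤ n)
    (hmin : ∀ y ∈ X, n ≤ G.dist i y) : distTo G i X = n := by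
  refine le_antisymm ((distTo_le_iff hG).2 ⟨x, hx, hle⟩) (le_iInf₂ fun y hy => ?_)
  rw [← (hG i y).coe_dist_eq_edist]
  exact_mod_cast hmin y hy

variable [Fintype V]

lemma mem_nbhd (hG : G.Connected) : i ∈ nbhd G X n ↔ ∃ x ∈ X, G.dist i x ≤ n := by
  simp only [nbhd, Finset.mem_filter, Finset.mem_univ, true_and, distTo_le_iff hG]

lemma notMem_nbhd (hG : G.Connected) : i ∉ nbhd G X n ↔ ∀ x ∈ X, n < G.dist i x := by
  simp only [mem_nbhd hG, not_exists, not_and, not_le]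

lemma subset_nbhd (hG : G.Connected) (X : Finset V) (n : ℕ) : X ⊆ nbhd G X n := fun i hi =>
  (mem_nbhd hG).2 ⟨i, hi, G.dist_self.trans_le n.zero_le⟩

lemma nbhd_mono (hG : G.Connected) (X : Finset V) {m n : ℕ} (hmn : m ≤ n) :
    nbhd G X m ⊆ nbhd G X n := fun _ hi =>
  let ⟨x, hx, hle⟩ := (mem_nbhd hG).1 hi
  (mem_nbhd hG).2 ⟨x, hx, hle.trans hmn⟩

variable [DecidableEq V]

lemma mem_surface : i ∈ surface G X ↔ i ∈ X ∧ ∃ j, j ∉ X ∧ G.Adj i j := by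
  simp only [surface, Finset.mem_filter]

lemma exists_mem_surface_dist_add_dist (hG : G.Connected) (hi : i ∈ X) (hj : j ∉ X) :
    ∃ u ∈ surface G X, G.dist i u + G.dist u j = G.dist i j := by
  obtain ⟨w, hw⟩ := hG.exists_walk_length_eq_dist i j
  obtain ⟨n, hn, mem, notMem⟩ :=
    exists_getVert_mem_getVert_succ_notMem w (Finset.mem_coe.2 hi) (Finset.mem_coe.not.2 hj)
  exact ⟨w.getVert n, mem_surface.2 ⟨mem, _, notMem, w.adj_getVert_succ hn⟩,
    dist_add_dist_getVert_of_length_eq_dist hw n⟩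

lemma mem_shell_of_notMem (hG : G.Connected) {x : V} (hi : i ∉ X) (hx : x ∈ X)
    (hmin : ∀ y ∈ X, G.dist i x ≤ G.dist i y) : i ∈ shell G X (G.dist i x) := by
  have dist_pos : 0 < G.dist i x := hG.pos_dist_of_ne fun h => hi (h ▸ hx)
  obtain ⟨u, hu, dist_add⟩ := exists_mem_surface_dist_add_dist hG hx hi
  rw [shell, if_neg (by omega), Finset.mem_filter, Finset.mem_compl, Int.natAbs_natCast]
  refine ⟨hi, distTo_eq_of_forall_le hG hu ?_ fun y hy => hmin y (mem_surface.1 hy).1⟩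
  rw [G.dist_comm, G.dist_comm (u := i)]
  omega

lemma mem_shell_of_mem (hG : G.Connected) {u : V} (hi : i ∈ X) (hu : u ∈ surface G X)
    (hmin : ∀ y ∈ surface G X, G.dist i u ≤ G.dist i y) : i ∈ shell G X (-(G.dist i u : ℤ)) := by
  rw [shell, if_pos (by omega), Finset.mem_filter, Int.natAbs_neg, Int.natAbs_natCast]
  exact ⟨hi, distTo_eq_of_forall_le hG hu le_rfl hmin⟩

lemma mem_shell_of_adj (hG : G.Connected) (hi : i ∈ nbhd G X n) (hj : j ∉ nbhd G X n)
    (hij : G.Adj i j) : i ∈ shell G X n := by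
  obtain ⟨x, hx, dist_le⟩ := (mem_nbhd hG).1 hi
  rw [notMem_nbhd hG] at hj
  have le_dist (y : V) (hy : y ∈ X) : n ≤ G.dist i y := by
    have triangle : G.dist j y ≤ G.dist j i + G.dist i y := hG.dist_triangle
    rw [SimpleGraph.dist_eq_one_iff_adj.2 hij.symm] at triangle
    have := hj y hy
    omega
  have dist_eq : G.dist i x = n := le_antisymm dist_le (le_dist x hx)
  by_cases hiX : i ∈ X
  · obtain rfl : n = 0 := Nat.le_zero.1 ((le_dist i hiX).trans_eq G.dist_self)
    have hjX : j ∉ X := fun hjX => (hj j hjX).ne' G.dist_self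
    simpa only [G.dist_self, Nat.cast_zero, neg_zero] using mem_shell_of_mem hG hiX
      (mem_surface.2 ⟨hiX, j, hjX, hij⟩) fun y _ => G.dist_self.trans_le (Nat.zero_le _)
  · rw [← dist_eq]
    exact mem_shell_of_notMem hG hiX hx fun y hy => dist_eq ▸ le_dist y hy

lemma exists_mem_shell_add_lt_dist (hG : G.Connected) {m : ℕ} (hi : i ∈ nbhd G X m)
    (hj : j ∉ nbhd G X n) : ∃ l : ℤ, l ≤ m ∧ i ∈ shell G X l ∧ n < G.dist i j + l := by
  rw [notMem_nbhd hG] at hj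
  obtain ⟨x₀, hx₀, dist_x₀_le⟩ := (mem_nbhd hG).1 hi
  by_cases hiX : i ∈ X
  · have hjX : j ∉ X := fun hjX => (hj j hjX).not_ge (G.dist_self.trans_le n.zero_le)
    obtain ⟨u, hu, dist_add⟩ := exists_mem_surface_dist_add_dist hG hiX hjX
    obtain ⟨u₀, hu₀, hmin⟩ := Finset.exists_min_image (surface G X) (G.dist i) ⟨u, hu⟩
    refine ⟨_, by omega, mem_shell_of_mem hG hiX hu₀ hmin, ?_⟩
    have dist_u₀_le := hmin u hu
    have lt_dist_u := hj u (mem_surface.1 hu).1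
    rw [G.dist_comm] at lt_dist_u
    omega
  · obtain ⟨x, hx, hmin⟩ := Finset.exists_min_image X (G.dist i) ⟨x₀, hx₀⟩
    have dist_x_le := hmin x₀ hx₀
    refine ⟨_, by omega, mem_shell_of_notMem hG hiX hx hmin, ?_⟩
    have lt_dist_x := hj x hx
    have triangle : G.dist j x ≤ G.dist j i + G.dist i x := hG.dist_triangle
    rw [G.dist_comm (u := j) (v := i)] at triangle
    omega

end Distance

section FarPairs

variable {V : Type*} [Fintype V] {G : SimpleGraph V} {h r s : ℕ}

lemma mem_sphere {i j : V} : j ∈ sphere G i s ↔ G.dist i j = s := by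
  simp only [sphere, Finset.mem_filter, Finset.mem_univ, true_and]

variable [DecidableEq V] {X : Finset V}

/-- The pairs of a site of `X[h]` and a site outside `X[r]` at distance `s` from each other. -/
def farPairs (G : SimpleGraph V) (X : Finset V) (h r s : ℕ) : Finset (V × V) :=
  {q ∈ nbhd G X h ×ˢ (nbhd G X r)ᶜ | G.dist q.1 q.2 = s}

lemma mem_farPairs {q : V × V} :
    q ∈ farPairs G X h r s ↔ q.1 ∈ nbhd G X h ∧ q.2 ∉ nbhd G X r ∧ G.dist q.1 q.2 = s := by
  simp only [farPairs, Finset.mem_filter, Finset.mem_product, Finset.mem_compl, and_assoc]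

lemma farPairs_subset_biUnion (hG : G.Connected) :
    farPairs G X h r s ⊆ (Finset.Icc ((r : ℤ) + 1 - s) h).biUnion fun l =>
      (shell G X l).biUnion fun i => (sphere G i s).image (Prod.mk i) := by
  intro q hq
  obtain ⟨hi, hj, rfl⟩ := mem_farPairs.1 hq
  obtain ⟨l, le_h, mem_shell, lt_add⟩ := exists_mem_shell_add_lt_dist hG hi hj
  simp only [Finset.mem_biUnion, Finset.mem_image, Finset.mem_Icc, mem_sphere]
  exact ⟨l, ⟨by omega, le_h⟩, q.1, mem_shell, q.2, rfl, rfl⟩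

lemma card_farPairs_le_of_card_shell_le (hG : G.Connected) (hhr : h ≤ r) {M : ℝ}
    (hM : ∀ i, ((sphere G i s).card : ℝ) ≤ M)
    (hshell : ∀ l : ℤ, l ≤ h → (shell G X l).card ≤ (shell G X h).card) :
    ((farPairs G X h r s).card : ℝ) ≤ (s - (r - h) : ℕ) * ((shell G X h).card * M) := by
  obtain ⟨i₀⟩ := hG.nonempty
  have hM₀ : 0 ≤ M := (Nat.cast_nonneg _).trans (hM i₀)
  have card_Icc : (Finset.Icc ((r : ℤ) + 1 - s) h).card = s - (r - h) := by
    rw [Int.card_Icc]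
    omega
  have card_le : (farPairs G X h r s).card ≤
      ∑ l ∈ Finset.Icc ((r : ℤ) + 1 - s) h, ∑ i ∈ shell G X l, (sphere G i s).card :=
    ((Finset.card_le_card (farPairs_subset_biUnion hG)).trans Finset.card_biUnion_le).trans <|
      Finset.sum_le_sum fun _ _ => Finset.card_biUnion_le.trans <|
        Finset.sum_le_sum fun _ _ => Finset.card_image_le
  calc ((farPairs G X h r s).card : ℝ)
      ≤ ∑ l ∈ Finset.Icc ((r : ℤ) + 1 - s) h, ∑ i ∈ shell G X l, ((sphere G i s).card : ℝ) := by
        exact_mod_cast card_le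
    _ ≤ ∑ _l ∈ Finset.Icc ((r : ℤ) + 1 - s) h, (shell G X h).card * M := by
        refine Finset.sum_le_sum fun l hl => ?_
        have shell_le := hshell l (Finset.mem_Icc.1 hl).2
        refine (Finset.sum_le_card_nsmul _ _ M fun i _ => hM i).trans ?_
        rw [nsmul_eq_mul]
        gcongr
    _ = (s - (r - h) : ℕ) * ((shell G X h).card * M) := by
        rw [Finset.sum_const, nsmul_eq_mul, card_Icc]

end FarPairs

section MassTransport

variable {Γ α β ι : Type*} [Group Γ] [MulAction Γ β] {P E : Finset β}

lemma card_filter_smul_mem [DecidableEq β] (hE : ∀ g : Γ, ∀ q ∈ E, g • q ∈ E) (hPE : P ⊆ E)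
    (g : Γ) :
    Finset.card {q ∈ E | g • q ∈ P} = P.card := by
  refine Finset.card_equiv (MulAction.toPerm g) fun q => ?_
  rw [Finset.mem_filter, MulAction.toPerm_apply, and_iff_right_iff_imp]
  exact fun hq => inv_smul_smul g q ▸ hE g⁻¹ _ (hPE hq)

variable [MulAction Γ α] [Fintype α] [MulAction.IsPretransitive Γ α]

lemma card_mul_card_smul_eq [Fintype Γ] [DecidableEq α] (u v : α) :
    Fintype.card α * Finset.card {g : Γ | g • u = v} = Fintype.card Γ := by
  have card_eq (v' : α) : Finset.card {g : Γ | g • u = v'} = Finset.card {g : Γ | g • u = v} := by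
    obtain ⟨k, rfl⟩ := MulAction.exists_smul_eq Γ v' v
    exact Finset.card_equiv (Equiv.mulLeft k) fun g => by
      simp only [Finset.mem_filter, Finset.mem_univ, true_and, Equiv.coe_mulLeft, mul_smul,
        smul_left_cancel_iff]
  rw [← Finset.card_univ (α := Γ), Finset.card_eq_sum_card_fiberwise (s := Finset.univ)
    (f := fun g : Γ => g • u) (t := Finset.univ) fun _ _ => Finset.mem_coe.2 (Finset.mem_univ _)]
  simp only [card_eq, Finset.sum_const, Finset.card_univ, smul_eq_mul]

/- Double counting of the pairs `(g, q)` with `g • q ∈ P`: for each time `a` and each target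
`v ∈ B`, transitivity spreads the images `g • path q a` evenly over the space. -/
lemma card_mul_card_le_of_smul_path_mem [Finite Γ] (hE : ∀ g : Γ, ∀ q ∈ E, g • q ∈ E)
    (hPE : P ⊆ E) (path : β → ι → α) (T : Finset ι) (B : Finset α)
    (hB : ∀ g : Γ, ∀ q ∈ E, g • q ∈ P → ∃ a ∈ T, g • path q a ∈ B) :
    Fintype.card α * P.card ≤ T.card * (B.card * E.card) := by
  classical
  have := Classical.decEq α
  have := Fintype.ofFinite Γ
  refine le_of_mul_le_mul_left ?_ (Fintype.card_pos (α := Γ))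
  have subset_biUnion (q : β) (hq : q ∈ E) : ({g | g • q ∈ P} : Finset Γ) ⊆
      T.biUnion fun a => B.biUnion fun v => {g | g • path q a = v} := fun g hg => by
    obtain ⟨a, ha, mem⟩ := hB g q hq (Finset.mem_filter.1 hg).2
    simp only [Finset.mem_biUnion, Finset.mem_filter, Finset.mem_univ, true_and]
    exact ⟨a, ha, _, mem, rfl⟩
  calc Fintype.card Γ * (Fintype.card α * P.card)
      = Fintype.card α * ∑ g : Γ, Finset.card {q ∈ E | g • q ∈ P} := by
        simp only [card_filter_smul_mem hE hPE, Finset.sum_const, Finset.card_univ, smul_eq_mul]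
        ring
    _ = Fintype.card α * ∑ q ∈ E, Finset.card {g : Γ | g • q ∈ P} := by
        simp only [Finset.card_filter]
        rw [Finset.sum_comm]
    _ ≤ Fintype.card α *
          ∑ q ∈ E, ∑ a ∈ T, ∑ v ∈ B, Finset.card {g : Γ | g • path q a = v} := by
        gcongr with q hq
        exact (Finset.card_le_card (subset_biUnion q hq)).trans <|
          Finset.card_biUnion_le.trans <| Finset.sum_le_sum fun a _ => Finset.card_biUnion_le
    _ = Fintype.card Γ * (T.card * (B.card * E.card)) := by
        simp only [Finset.mul_sum, card_mul_card_smul_eq, Finset.sum_const, smul_eq_mul]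
        ring

end MassTransport

section Homogeneous

variable {W : Type*} {L : SimpleGraph W}

lemma dist_map_le_dist {V : Type*} {G : SimpleGraph V} (hG : G.Connected) (f : G →g L)
    (i j : V) : L.dist (f i) (f j) ≤ G.dist i j := by
  obtain ⟨w, hw⟩ := hG.exists_walk_length_eq_dist i j
  exact (SimpleGraph.dist_le (w.map f)).trans_eq ((w.length_map f).trans hw)

lemma dist_iso (hL : L.Connected) (φ : L ≃g L) (x y : W) : L.dist (φ x) (φ y) = L.dist x y := by
  refine le_antisymm (dist_map_le_dist hL φ.toHom x y) ?_
  have symm_le : L.dist (φ.symm (φ x)) (φ.symm (φ y)) ≤ L.dist (φ x) (φ y) :=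
    dist_map_le_dist hL φ.symm.toHom _ _
  rwa [φ.symm_apply_apply, φ.symm_apply_apply] at symm_le

lemma IsHomogeneous.isPretransitive (hom : IsHomogeneous L) :
    MulAction.IsPretransitive (L ≃g L) W :=
  ⟨hom⟩

variable [Fintype W]

lemma card_dist_eq_le {s : ℕ} {M : ℝ} (hM : ∀ x, ((sphere L x s).card : ℝ) ≤ M) :
    (Finset.card {q : W × W | L.dist q.1 q.2 = s} : ℝ) ≤ Fintype.card W * M := by
  have card_eq : Finset.card {q : W × W | L.dist q.1 q.2 = s} = ∑ x, (sphere L x s).card := by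
    simp only [Finset.card_filter, Fintype.sum_prod_type, sphere]
  rw [card_eq, Nat.cast_sum, ← nsmul_eq_mul, ← Finset.card_univ]
  exact Finset.sum_le_card_nsmul _ _ M fun x _ => hM x

lemma card_le_of_forall_geodesic_meets (hL : L.Connected) (hom : IsHomogeneous L)
    {s : ℕ} {M : ℝ} (hM : ∀ x, ((sphere L x s).card : ℝ) ≤ M) {P : Finset (W × W)}
    (hP : ∀ q ∈ P, L.dist q.1 q.2 = s) (T : Finset ℕ) (B : Finset W)
    (hB : ∀ q ∈ P, ∀ w : L.Walk q.1 q.2, w.length = s → ∃ n ∈ T, w.getVert n ∈ B) :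
    (P.card : ℝ) ≤ T.card * (B.card * M) := by
  classical
  have : Finite (L ≃g L) := DFunLike.finite _
  have := hom.isPretransitive
  choose geodesic hgeodesic using fun q : W × W => hL.exists_walk_length_eq_dist q.1 q.2
  have meets (φ : L ≃g L) (q : W × W) (hq : L.dist q.1 q.2 = s) (hφ : φ • q ∈ P) :
      ∃ n ∈ T, φ • (geodesic q).getVert n ∈ B := by
    obtain ⟨n, hn, mem⟩ := hB _ hφ ((geodesic q).map φ.toHom)
      (((geodesic q).length_map _).trans ((hgeodesic q).trans hq))
    rw [SimpleGraph.Walk.getVert_map] at mem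
    exact ⟨n, hn, mem⟩
  have double_count := card_mul_card_le_of_smul_path_mem (Γ := L ≃g L) (P := P)
    (E := {q | L.dist q.1 q.2 = s})
    (fun φ q hq => Finset.mem_filter.2
      ⟨Finset.mem_univ _, (dist_iso hL φ _ _).trans (Finset.mem_filter.1 hq).2⟩)
    (fun q hq => Finset.mem_filter.2 ⟨Finset.mem_univ _, hP q hq⟩)
    (fun q => (geodesic q).getVert) T B fun φ q hq => meets φ q (Finset.mem_filter.1 hq).2
  have card_pos : (0 : ℝ) < Fintype.card W := by
    have := hL.nonempty
    exact_mod_cast Fintype.card_pos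
  refine le_of_mul_le_mul_left ?_ card_pos
  calc (Fintype.card W * P.card : ℝ)
      ≤ T.card * (B.card * Finset.card {q : W × W | L.dist q.1 q.2 = s}) := by
        exact_mod_cast double_count
    _ ≤ T.card * (B.card * (Fintype.card W * M)) := by
        gcongr
        exact card_dist_eq_le hM
    _ = Fintype.card W * (T.card * (B.card * M)) := by ring

end Homogeneous

section ConvexRegion

variable {V W : Type*} {G : SimpleGraph V} {L : SimpleGraph W}

lemma exists_walk_map_eq (f : G ↪g L) {x y : W} (w : L.Walk x y)
    (hw : ∀ v ∈ w.support, v ∈ Set.range f) {i j : V} (hi : f i = x) (hj : f j = y) :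
    ∃ w' : G.Walk i j, w'.map f.toHom = w.copy hi.symm hj.symm := by
  induction w generalizing i with
  | nil =>
    subst hj
    obtain rfl := f.injective hi
    exact ⟨.nil, rfl⟩
  | cons adj w ih =>
    rw [SimpleGraph.Walk.support_cons] at hw
    obtain ⟨k, rfl⟩ := hw _ (List.mem_cons_of_mem _ w.start_mem_support)
    subst hi hj
    obtain ⟨w', hw'⟩ := ih (fun v hv => hw v (List.mem_cons_of_mem _ hv)) rfl rfl
    exact ⟨.cons (f.map_adj_iff.1 adj) w', by rw [SimpleGraph.Walk.map_cons, hw']; rfl⟩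

/-- The convexity condition of `IsLatticeRegion`: geodesics between points of the image of `G` stay
in the image. -/
def IsGeodesicallyConvex (f : G ↪g L) : Prop :=
  ∀ (i j : V) (v : W), L.dist (f i) v + L.dist v (f j) = L.dist (f i) (f j) → v ∈ Set.range f

lemma IsGeodesicallyConvex.exists_walk_map_eq {f : G ↪g L} (hf : IsGeodesicallyConvex f) {i j : V}
    {w : L.Walk (f i) (f j)} (hw : w.length = L.dist (f i) (f j)) :
    ∃ w' : G.Walk i j, w'.map f.toHom = w := by
  refine LongRange.exists_walk_map_eq f w (fun v hv => ?_) rfl rfl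
  obtain ⟨n, rfl, -⟩ := SimpleGraph.Walk.mem_support_iff_exists_getVert.1 hv
  exact hf i j _ (dist_add_dist_getVert_of_length_eq_dist hw n)

lemma IsGeodesicallyConvex.dist_map_eq {f : G ↪g L} (hf : IsGeodesicallyConvex f)
    (hG : G.Connected) (hL : L.Connected) (i j : V) : L.dist (f i) (f j) = G.dist i j := by
  refine le_antisymm (dist_map_le_dist hG f.toHom i j) ?_
  obtain ⟨w, hw⟩ := hL.exists_walk_length_eq_dist (f i) (f j)
  obtain ⟨w', rfl⟩ := hf.exists_walk_map_eq hw
  rw [← hw, SimpleGraph.Walk.length_map]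
  exact SimpleGraph.dist_le w'

variable [Fintype V] [DecidableEq V] {X : Finset V} {h r s : ℕ}

lemma exists_getVert_mem_shell (hG : G.Connected) (hhr : h ≤ r) {q : V × V}
    (hq : q ∈ farPairs G X h r s) (w : G.Walk q.1 q.2) (hw : w.length = s) :
    ∃ n ∈ Finset.range (s - (r - h)), w.getVert n ∈ shell G X h := by
  obtain ⟨hi, hj, -⟩ := mem_farPairs.1 hq
  obtain ⟨n, hn, mem, notMem⟩ := exists_getVert_mem_getVert_succ_notMem w (Finset.mem_coe.2 hi)
    (Finset.mem_coe.not.2 (mt (@nbhd_mono _ _ _ hG X _ _ hhr _) hj))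
  refine ⟨n, Finset.mem_range.2 ?_, mem_shell_of_adj hG mem notMem (w.adj_getVert_succ hn)⟩
  obtain ⟨x, hx, dist_x_le⟩ := (mem_nbhd hG).1 mem
  have lt_dist_x : r < G.dist q.2 x := (notMem_nbhd hG).1 hj x hx
  have dist_le := dist_getVert_le_length_sub w n
  have triangle : G.dist q.2 x ≤ G.dist q.2 (w.getVert n) + G.dist (w.getVert n) x :=
    hG.dist_triangle
  rw [G.dist_comm (u := q.2) (v := w.getVert n)] at triangle
  omega

lemma IsGeodesicallyConvex.card_farPairs_le [Fintype W] {f : G ↪g L}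
    (hf : IsGeodesicallyConvex f) (hG : G.Connected) (hL : L.Connected) (hom : IsHomogeneous L)
    (hhr : h ≤ r) {M : ℝ} (hM : ∀ x, ((sphere L x s).card : ℝ) ≤ M) :
    ((farPairs G X h r s).card : ℝ) ≤ (s - (r - h) : ℕ) * ((shell G X h).card * M) := by
  classical
  have card_le := card_le_of_forall_geodesic_meets hL hom hM
    (P := (farPairs G X h r s).map (f.toEmbedding.prodMap f.toEmbedding)) ?_
    (Finset.range (s - (r - h))) ((shell G X h).map f.toEmbedding) ?_
  · rwa [Finset.card_map, Finset.card_map, Finset.card_range] at card_le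
  · simp only [Finset.forall_mem_map]
    exact fun q hq => (hf.dist_map_eq hG hL _ _).trans (mem_farPairs.1 hq).2.2
  · simp only [Finset.forall_mem_map]
    intro q hq w hw
    obtain ⟨w', rfl⟩ := hf.exists_walk_map_eq (hw.trans
      ((hf.dist_map_eq hG hL _ _).trans (mem_farPairs.1 hq).2.2).symm)
    obtain ⟨n, hn, mem⟩ := exists_getVert_mem_shell hG hhr hq w' ((w'.length_map _).symm.trans hw)
    exact ⟨n, hn, w'.getVert_map f.toHom n ▸ Finset.mem_map_of_mem f.toEmbedding mem⟩

lemma card_farPairs_le (hG : G.Connected) {D : ℕ} {γ : ℝ} (hlat : IsLatticeConstant G D γ)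
    (hhr : h ≤ r)
    (hreg : IsLatticeRegion G D γ ∨ ∀ l : ℤ, l ≤ h → (shell G X l).card ≤ (shell G X h).card)
    (hs : 1 ≤ s) :
    ((farPairs G X h r s).card : ℝ) ≤
      (s - (r - h) : ℕ) * ((shell G X h).card * (γ * (s : ℝ) ^ ((D : ℝ) - 1))) := by
  rcases hreg with ⟨N, L, f, hL, hom, hLlat, hf⟩ | hshell
  · exact IsGeodesicallyConvex.card_farPairs_le hf hG hL hom hhr fun x => (hLlat x s hs).2
  · exact card_farPairs_le_of_card_shell_le hG hhr (fun i => (hlat i s hs).2) hshell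

end ConvexRegion

section TailSum

lemma mul_rpow_succ_le_sub {p x : ℝ} (hp : 0 ≤ p) (hx : 0 < x) :
    p * (x + 1) ^ (-(p + 1)) ≤ x ^ (-p) - (x + 1) ^ (-p) := by
  have succ_pos : 0 < x + 1 := by linarith
  have log_le : Real.log (x / (x + 1)) ≤ -(x + 1)⁻¹ :=
    (Real.log_le_sub_one_of_pos (by positivity)).trans_eq (by field)
  have bernoulli : p * (x + 1)⁻¹ + 1 ≤ (x / (x + 1)) ^ (-p) := by
    rw [Real.rpow_def_of_pos (by positivity)]
    refine le_trans ?_ (Real.add_one_le_exp _)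
    linarith [mul_le_mul_of_nonneg_left log_le hp]
  have split_ratio : x ^ (-p) = (x + 1) ^ (-p) * (x / (x + 1)) ^ (-p) := by
    rw [← Real.mul_rpow succ_pos.le (by positivity), mul_div_cancel₀ _ succ_pos.ne']
  rw [neg_add, Real.rpow_add succ_pos, Real.rpow_neg_one, split_ratio]
  linarith [mul_le_mul_of_nonneg_left bernoulli (Real.rpow_nonneg succ_pos.le (-p))]

/-- The integral `∫ u in Ioi x, u * (m + u) ^ (-(κ + 2))`, in closed form: a decreasing potential
which telescopes sums of `u * (m + u + 1) ^ (-(κ + 2))`. -/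
def tailIntegral (κ m x : ℝ) : ℝ :=
  x * ((m + x) ^ (-(κ + 1)) / (κ + 1)) + (m + x) ^ (-κ) / (κ * (κ + 1))

lemma mul_rpow_le_tailIntegral_sub {κ m x : ℝ} (hκ : 0 < κ) (hm : 0 < m) (hx : 0 ≤ x) :
    x * (m + x + 1) ^ (-(κ + 2)) ≤ tailIntegral κ m x - tailIntegral κ m (x + 1) := by
  have pos : 0 < m + x := by positivity
  have le_sub : (m + x + 1) ^ (-(κ + 2)) ≤
      (m + x) ^ (-(κ + 1)) / (κ + 1) - (m + x + 1) ^ (-(κ + 1)) / (κ + 1) := by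
    rw [← sub_div, le_div_iff₀' (by positivity)]
    exact (show κ + 2 = κ + 1 + 1 by ring) ▸ mul_rpow_succ_le_sub (by positivity) pos
  have succ_le_sub : (m + x + 1) ^ (-(κ + 1)) / (κ + 1) ≤
      (m + x) ^ (-κ) / (κ * (κ + 1)) - (m + x + 1) ^ (-κ) / (κ * (κ + 1)) := by
    rw [← sub_div, ← mul_div_mul_left _ (κ + 1) hκ.ne']
    gcongr
    exact mul_rpow_succ_le_sub hκ.le pos
  rw [tailIntegral, tailIntegral, ← add_assoc]
  linarith [mul_le_mul_of_nonneg_left le_sub hx]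

lemma sum_mul_rpow_le {κ m : ℝ} (hκ : 0 < κ) (hm : 0 < m) (n : ℕ) :
    ∑ u ∈ Finset.range n, (u : ℝ) * (m + u + 1) ^ (-(κ + 2)) ≤ m ^ (-κ) / (κ * (κ + 1)) := by
  calc ∑ u ∈ Finset.range n, (u : ℝ) * (m + u + 1) ^ (-(κ + 2))
      ≤ ∑ u ∈ Finset.range n, (tailIntegral κ m u - tailIntegral κ m (u + 1 : ℕ)) := by
        refine Finset.sum_le_sum fun u _ => ?_
        rw [Nat.cast_succ]
        exact mul_rpow_le_tailIntegral_sub hκ hm u.cast_nonneg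
    _ = tailIntegral κ m 0 - tailIntegral κ m n := by
        rw [Finset.sum_range_sub' (fun u : ℕ => tailIntegral κ m u), Nat.cast_zero]
    _ ≤ tailIntegral κ m 0 := sub_le_self _ (by unfold tailIntegral; positivity)
    _ = m ^ (-κ) / (κ * (κ + 1)) := by rw [tailIntegral, zero_mul, zero_add, add_zero]

lemma sum_tsub_mul_rpow_le {κ : ℝ} (hκ : 0 < κ) {m : ℕ} (hm : 0 < m) (n : ℕ) :
    ∑ s ∈ Finset.range n, ((s - m : ℕ) : ℝ) * ((s : ℝ) + 1) ^ (-(κ + 2)) ≤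
      (m : ℝ) ^ (-κ) / (κ * (κ + 1)) := by
  calc ∑ s ∈ Finset.range n, ((s - m : ℕ) : ℝ) * ((s : ℝ) + 1) ^ (-(κ + 2))
      ≤ ∑ s ∈ Finset.range (m + n), ((s - m : ℕ) : ℝ) * ((s : ℝ) + 1) ^ (-(κ + 2)) :=
        Finset.sum_le_sum_of_subset_of_nonneg (Finset.range_mono (Nat.le_add_left n m))
          fun _ _ _ => by positivity
    _ = ∑ u ∈ Finset.range n, (u : ℝ) * ((m : ℝ) + u + 1) ^ (-(κ + 2)) := by
        have head_eq_zero (s : ℕ) (hs : s ∈ Finset.range m) :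
            ((s - m : ℕ) : ℝ) * ((s : ℝ) + 1) ^ (-(κ + 2)) = 0 := by
          rw [Nat.sub_eq_zero_of_le (Finset.mem_range.1 hs).le, Nat.cast_zero, zero_mul]
        simp only [Finset.sum_range_add, Finset.sum_eq_zero head_eq_zero, zero_add,
          Nat.add_sub_cancel_left, Nat.cast_add]
    _ ≤ (m : ℝ) ^ (-κ) / (κ * (κ + 1)) := sum_mul_rpow_le hκ (Nat.cast_pos.2 hm) n

end TailSum

section DecaySum

variable {V : Type*} {G : SimpleGraph V} {α : ℝ}

/-- The power-law kernel `(d_{i,j} + 1) ^ (-α)` of `PowerLawDecay` and `ConvolutionBound`. -/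
def decayKernel (G : SimpleGraph V) (α : ℝ) (i j : V) : ℝ := ((G.dist i j : ℝ) + 1) ^ (-α)

lemma decayKernel_pos (i j : V) : 0 < decayKernel G α i j :=
  Real.rpow_pos_of_pos (by positivity) _

variable [Fintype V] {D r h : ℕ} {γ : ℝ}

lemma IsLatticeConstant.one_le (hlat : IsLatticeConstant G D γ) (i : V) : 1 ≤ γ := by
  have card_ball_le : ((ball G i 1).card : ℝ) ≤ γ := by
    simpa only [Nat.cast_one, Real.one_rpow, mul_one] using (hlat i 1 le_rfl).1
  have i_mem : i ∈ ball G i 1 := by simp [ball]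
  exact le_trans (by exact_mod_cast Finset.card_pos.2 ⟨i, i_mem⟩) card_ball_le

variable [DecidableEq V] {X : Finset V}

lemma farPairs_zero (hG : G.Connected) (hhr : h ≤ r) : farPairs G X h r 0 = ∅ := by
  refine Finset.eq_empty_of_forall_notMem fun q hq => ?_
  obtain ⟨fst_mem, snd_notMem, dist_eq⟩ := mem_farPairs.1 hq
  rw [hG.dist_eq_zero_iff] at dist_eq
  exact snd_notMem (dist_eq ▸ nbhd_mono hG X hhr fst_mem)

lemma exists_sum_nbhd_sum_compl_eq (G : SimpleGraph V) (X : Finset V) (h r : ℕ) (F : ℕ → ℝ) :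
    ∃ n, ∑ i ∈ nbhd G X h, ∑ j ∈ (nbhd G X r)ᶜ, F (G.dist i j) =
      ∑ s ∈ Finset.range n, (farPairs G X h r s).card * F s := by
  obtain ⟨n, hn⟩ := Finset.exists_nat_subset_range
    ((nbhd G X h ×ˢ (nbhd G X r)ᶜ).image fun q => G.dist q.1 q.2)
  refine ⟨n, ?_⟩
  calc ∑ i ∈ nbhd G X h, ∑ j ∈ (nbhd G X r)ᶜ, F (G.dist i j)
      = ∑ q ∈ nbhd G X h ×ˢ (nbhd G X r)ᶜ, F (G.dist q.1 q.2) :=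
        (Finset.sum_product _ _ fun q : V × V => F (G.dist q.1 q.2)).symm
    _ = ∑ s ∈ Finset.range n, ∑ q ∈ farPairs G X h r s, F (G.dist q.1 q.2) :=
        (Finset.sum_fiberwise_of_maps_to (g := fun q : V × V => G.dist q.1 q.2)
          (fun q hq => hn (Finset.mem_image_of_mem _ hq)) _).symm
    _ = ∑ s ∈ Finset.range n, (farPairs G X h r s).card * F s := by
        refine Finset.sum_congr rfl fun s _ => ?_
        rw [← nsmul_eq_mul]
        exact Finset.sum_eq_card_nsmul fun q hq => congrArg F (mem_farPairs.1 hq).2.2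

lemma card_farPairs_mul_sq_le (hG : G.Connected) (hD : 1 ≤ D) (hlat : IsLatticeConstant G D γ)
    (hhr : h ≤ r)
    (hreg : IsLatticeRegion G D γ ∨ ∀ l : ℤ, l ≤ h → (shell G X l).card ≤ (shell G X h).card)
    (s : ℕ) :
    (farPairs G X h r s).card * (((s : ℝ) + 1) ^ (-α)) ^ 2 ≤
      (shell G X h).card * γ *
        ((s - (r - h) : ℕ) * ((s : ℝ) + 1) ^ (-(2 * α - D - 1 + 2))) := by
  obtain ⟨i⟩ := hG.nonempty
  have one_le := hlat.one_le i
  rcases Nat.eq_zero_or_pos s with rfl | hs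
  · rw [farPairs_zero hG hhr, Finset.card_empty, Nat.cast_zero, zero_mul]
    positivity
  have pow_le : (s : ℝ) ^ ((D : ℝ) - 1) * (((s : ℝ) + 1) ^ (-α)) ^ 2 ≤
      ((s : ℝ) + 1) ^ (-(2 * α - D - 1 + 2)) := by
    calc (s : ℝ) ^ ((D : ℝ) - 1) * (((s : ℝ) + 1) ^ (-α)) ^ 2
        ≤ ((s : ℝ) + 1) ^ ((D : ℝ) - 1) * (((s : ℝ) + 1) ^ (-α)) ^ 2 := by
          gcongr
          · exact sub_nonneg.2 (Nat.one_le_cast.2 hD)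
          · linarith
      _ = ((s : ℝ) + 1) ^ (-(2 * α - D - 1 + 2)) := by
          rw [← Real.rpow_mul_natCast (by positivity), ← Real.rpow_add (by positivity)]
          congr 1
          push_cast
          ring
  calc (farPairs G X h r s).card * (((s : ℝ) + 1) ^ (-α)) ^ 2
      ≤ (s - (r - h) : ℕ) * ((shell G X h).card * (γ * (s : ℝ) ^ ((D : ℝ) - 1))) *
          (((s : ℝ) + 1) ^ (-α)) ^ 2 := by
        gcongr
        exact card_farPairs_le hG hlat hhr hreg hs
    _ = (shell G X h).card * γ * ((s - (r - h) : ℕ) *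
          ((s : ℝ) ^ ((D : ℝ) - 1) * (((s : ℝ) + 1) ^ (-α)) ^ 2)) := by ring
    _ ≤ _ := by gcongr

lemma sum_decayKernel_sq_le (hG : G.Connected) (hD : 1 ≤ D) (hlat : IsLatticeConstant G D γ)
    (hα : (D : ℝ) + 1 < 2 * α) (hhr : h < r)
    (hreg : IsLatticeRegion G D γ ∨
      ∀ l : ℤ, l ≤ h → (shell G X l).card ≤ (shell G X h).card) :
    ∑ i ∈ nbhd G X h, ∑ j ∈ (nbhd G X r)ᶜ, decayKernel G α i j ^ 2 ≤
      (shell G X h).card * γ *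
        (((r - h : ℕ) : ℝ) ^ (-(2 * α - D - 1)) / ((2 * α - D - 1) * (2 * α - D - 1 + 1))) := by
  obtain ⟨i⟩ := hG.nonempty
  have one_le := hlat.one_le i
  obtain ⟨n, sum_eq⟩ :=
    exists_sum_nbhd_sum_compl_eq G X h r fun s => (((s : ℝ) + 1) ^ (-α)) ^ 2
  refine sum_eq.trans_le
    ((Finset.sum_le_sum fun s _ => card_farPairs_mul_sq_le hG hD hlat hhr.le hreg s).trans ?_)
  rw [← Finset.mul_sum]
  gcongr
  exact sum_tsub_mul_rpow_le (by linarith) (Nat.sub_pos_of_lt hhr) n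

lemma sub_half_rpow_neg_le {κ : ℝ} (hκ : 0 ≤ κ) (hr : 1 ≤ r) :
    ((r - r / 2 : ℕ) : ℝ) ^ (-κ) ≤ 2 ^ κ * (r : ℝ) ^ (-κ) := by
  have half_le : (r : ℝ) / 2 ≤ (r - r / 2 : ℕ) := by
    rw [div_le_iff₀ two_pos]
    exact_mod_cast (by omega : r ≤ (r - r / 2) * 2)
  refine (Real.rpow_le_rpow_of_nonpos (by positivity) half_le (neg_nonpos.2 hκ)).trans_eq ?_
  rw [Real.div_rpow (by positivity) two_pos.le, Real.rpow_neg two_pos.le, div_inv_eq_mul, mul_comm]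

lemma sqrt_sum_decayKernel_sq_le (hG : G.Connected) (hD : 1 ≤ D)
    (hlat : IsLatticeConstant G D γ) (hα : (D : ℝ) + 1 < 2 * α) (hr : 1 ≤ r)
    (hreg : IsLatticeRegion G D γ ∨
      ∀ l : ℤ, l ≤ (r / 2 : ℕ) → (shell G X l).card ≤ (shell G X (r / 2 : ℕ)).card) :
    √(∑ i ∈ nbhd G X (r / 2), ∑ j ∈ (nbhd G X r)ᶜ, decayKernel G α i j ^ 2) ≤
      2 ^ (α - (D : ℝ) / 2 - 1 / 2) * γ / (2 * α - D - 1) *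
        √(γ⁻¹ * (shell G X (r / 2 : ℕ)).card * (r : ℝ) ^ (-2 * α + D + 1)) := by
  obtain ⟨i⟩ := hG.nonempty
  have one_le := hlat.one_le i
  have sum_le := sum_decayKernel_sq_le hG hD hlat hα (Nat.div_lt_self hr one_lt_two) hreg
  have two_rpow_sq : ((2 : ℝ) ^ (α - (D : ℝ) / 2 - 1 / 2)) ^ 2 = 2 ^ (2 * α - D - 1) := by
    rw [← Real.rpow_mul_natCast two_pos.le]
    congr 1
    push_cast
    ring
  obtain ⟨κ, hκ⟩ : ∃ κ, κ = 2 * α - D - 1 := ⟨_, rfl⟩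
  have κ_pos : 0 < κ := by linarith
  rw [← hκ] at sum_le two_rpow_sq ⊢
  rw [show -2 * α + D + 1 = -κ by linarith]
  refine Real.sqrt_le_iff.2 ⟨by positivity, ?_⟩
  rw [mul_pow, div_pow, mul_pow, two_rpow_sq, Real.sq_sqrt (by positivity)]
  refine sum_le.trans ?_
  calc (shell G X (r / 2 : ℕ)).card * γ * (((r - r / 2 : ℕ) : ℝ) ^ (-κ) / (κ * (κ + 1)))
      ≤ (shell G X (r / 2 : ℕ)).card * γ * (2 ^ κ * (r : ℝ) ^ (-κ) / (κ * κ)) := by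
        gcongr
        · exact sub_half_rpow_neg_le κ_pos.le hr
        · linarith
    _ = 2 ^ κ * γ ^ 2 / κ ^ 2 * (γ⁻¹ * (shell G X (r / 2 : ℕ)).card * (r : ℝ) ^ (-κ)) := by
        field

end DecaySum

section Constants

variable {V : Type*} [Fintype V] {G : SimpleGraph V} {α J₀ lam : ℝ}

lemma PowerLawDecay.nonneg [DecidableEq V] {c : (V → Fin 4) → ℝ}
    (hdecay : PowerLawDecay G c J₀ α) (i : V) : 0 ≤ J₀ :=
  nonneg_of_mul_nonneg_left
    ((Finset.sum_nonneg fun _ _ => opNorm_nonneg _).trans (hdecay i i)) (decayKernel_pos i i)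

lemma ConvolutionBound.nonneg (hlam : ConvolutionBound G α lam) (i : V) : 0 ≤ lam :=
  nonneg_of_mul_nonneg_left ((Finset.sum_nonneg fun j _ =>
    (mul_pos (decayKernel_pos i j) (decayKernel_pos j i)).le).trans (hlam i i))
    (decayKernel_pos i i)

lemma mul_le_gTilde (g : ℝ) (hlam : 0 ≤ lam) (hJ₀ : 0 ≤ J₀) (k : ℕ) :
    J₀ * lam ≤ gTilde g lam J₀ k := by
  have one_le : (1 : ℝ) ≤ 3 ^ ((k : ℝ) / 2) := Real.one_le_rpow (by norm_num) (by positivity)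
  calc J₀ * lam = lam * (1 * J₀) := by ring
    _ ≤ lam * (3 ^ ((k : ℝ) / 2) * J₀) := by gcongr
    _ ≤ gTilde g lam J₀ k := le_max_right _ _

lemma exp_two_mul_abs_le_two {a b t : ℝ} (ha : 0 ≤ a) (hab : a ≤ b)
    (ht : |t| ≤ 1 / (2 * Real.exp 1 * b)) : Real.exp (2 * a * |t|) ≤ 2 := by
  have two_le_exp : 2 ≤ Real.exp 1 := by linarith [Real.add_one_le_exp (1 : ℝ)]
  have b_nonneg : 0 ≤ b := ha.trans hab
  have le_half : 2 * a * |t| ≤ 1 / 2 := by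
    have mul_le_one := mul_le_of_le_div₀ zero_le_one (by positivity) ht
    have two_mul_le : 2 * (2 * a * |t|) ≤ |t| * (2 * Real.exp 1 * b) :=
      calc 2 * (2 * a * |t|) = |t| * (2 * 2 * a) := by ring
        _ ≤ |t| * (2 * Real.exp 1 * b) := by gcongr
    linarith
  rw [← Real.le_log_iff_exp_le two_pos]
  linarith [Real.log_two_gt_d9]

lemma add_one_lt_two_mul {D : ℕ} (hD : 1 ≤ D) (hα : (D : ℝ) < α) : (D : ℝ) + 1 < 2 * α := by
  have one_le : (1 : ℝ) ≤ D := Nat.one_le_cast.2 hD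
  linarith

lemma rpow_mul_exp_le_constC {D : ℕ} {γ g t : ℝ} {k : ℕ} (hD : 1 ≤ D) (hα : (D : ℝ) < α)
    (hγ : 0 ≤ γ) (hJ₀ : 0 ≤ J₀) (hlam : 0 ≤ lam)
    (ht : |t| ≤ 1 / (2 * Real.exp 1 * gTilde g lam J₀ k)) :
    2 ^ (α - (D : ℝ) / 2 + 1 / 2) * J₀ * γ / (2 * α - D - 1) * Real.exp (2 * J₀ * lam * |t|) ≤
      constC α J₀ γ (gTilde g lam J₀ k) D := by
  have mul_le := mul_le_gTilde g hlam hJ₀ k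
  have gTilde_nonneg : 0 ≤ gTilde g lam J₀ k := le_trans (by positivity) mul_le
  have exp_le : Real.exp (2 * J₀ * lam * |t|) ≤ 2 :=
    mul_assoc 2 J₀ lam ▸ exp_two_mul_abs_le_two (by positivity) mul_le ht
  have κ_pos : 0 < 2 * α - D - 1 := by linarith [add_one_lt_two_mul hD hα]
  have second_term_nonneg : 0 ≤ 80 * gTilde g lam J₀ k * γ * 2 ^ (α - (D : ℝ) / 2) / (α - D) *
      √(2 * α - 2 * D + γ) := by
    have := sub_pos.2 hα
    positivity
  calc _ ≤ 2 ^ (α - (D : ℝ) / 2 + 1) * J₀ * γ / (2 * α - D - 1) * 2 := by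
        gcongr
        · norm_num
        · norm_num
    _ = 2 ^ (α - (D : ℝ) / 2 + 2) * J₀ * γ / (2 * α - D - 1) := by
        rw [show α - (D : ℝ) / 2 + 2 = α - D / 2 + 1 + 1 by ring,
          Real.rpow_add_one two_ne_zero (_ + 1)]
        ring
    _ ≤ constC α J₀ γ (gTilde g lam J₀ k) D := le_add_of_nonneg_right second_term_nonneg

end Constants

end LongRange

end

theorem theorem3_general {V : Type*} [Fintype V] [DecidableEq V]
    (G : SimpleGraph V) (hG : G.Connected)
    (D : ℕ) (hD : 1 ≤ D) (γ : ℝ) (hlat : LongRange.IsLatticeConstant G D γ)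
    (α : ℝ) (hα : (D : ℝ) + 1 < 2 * α)
    (c : (V → Fin 4) → ℝ) (J₀ : ℝ) (hdecay : LongRange.PowerLawDecay G c J₀ α)
    (lam : ℝ) (hlam : LongRange.ConvolutionBound G α lam)
    (X : Finset V) (r : ℕ) (hr : 1 ≤ r)
    (hreg : LongRange.IsLatticeRegion G D γ ∨
      ∀ l : ℤ, l ≤ ((r / 2 : ℕ) : ℤ) →
        (LongRange.shell G X l).card ≤ (LongRange.shell G X ((r / 2 : ℕ) : ℤ)).card)
    (W : LongRange.Op V) (hWX : LongRange.ActsOn X W) (t : ℝ) :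
    LongRange.frobNorm
        (LongRange.evolve (LongRange.hamiltonian c) t W
          - LongRange.localApprox (LongRange.nbhd G X r)
              (LongRange.evolve (LongRange.hamiltonian c) t W))
      ≤ 2 ^ (α - (D : ℝ) / 2 + 1 / 2) * J₀ * γ / (2 * α - D - 1) *
          Real.exp (2 * J₀ * lam * |t|) * |t| * LongRange.opNorm W
          * Real.sqrt (γ⁻¹ * ((LongRange.shell G X ((r / 2 : ℕ) : ℤ)).card : ℝ)
              * (r : ℝ) ^ (-2 * α + D + 1)) := by
  obtain ⟨i⟩ := hG.nonempty
  have J₀_nonneg := hdecay.nonneg i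
  have opNorm_nonneg := LongRange.opNorm_nonneg W
  have leakage_le := LongRange.frobNorm_leakage_evolve_hamiltonian_le
    (K := LongRange.decayKernel G α) LongRange.decayKernel_pos J₀_nonneg (hlam.nonneg i) hdecay
    hlam (LongRange.nbhd_mono hG X (Nat.div_le_self r 2))
    (LongRange.localAlgebra_mono (LongRange.subset_nbhd hG X (r / 2)) hWX) t
  have sqrt_le := LongRange.sqrt_sum_decayKernel_sq_le hG hD hlat hα hr hreg
  refine leakage_le.trans ((mul_le_mul_of_nonneg_left sqrt_le (by positivity)).trans_eq ?_)
  rw [show α - (D : ℝ) / 2 + 1 / 2 = α - D / 2 - 1 / 2 + 1 by ring,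
    Real.rpow_add_one two_ne_zero]
  ring

theorem theorem3 {V : Type*} [Fintype V] [DecidableEq V]
    (G : SimpleGraph V) (hG : G.Connected)
    (D : ℕ) (hD : 1 ≤ D) (γ : ℝ) (hγ : 1 ≤ γ) (hlat : LongRange.IsLatticeConstant G D γ)
    (α : ℝ) (hα : (D : ℝ) < α)
    (k : ℕ) (c : (V → Fin 4) → ℝ) (hk : LongRange.IsKLocal c k)
    (J₀ : ℝ) (hJ₀ : 0 < J₀) (hdecay : LongRange.PowerLawDecay G c J₀ α)
    (g : ℝ) (hg : LongRange.OneSiteEnergyBound c g)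
    (lam : ℝ) (hlam : LongRange.ConvolutionBound G α lam)
    (X : Finset V) (r : ℕ) (hr : 1 ≤ r)
    (hreg : LongRange.IsLatticeRegion G D γ ∨
      ∀ l : ℤ, l ≤ ((r / 2 : ℕ) : ℤ) →
        (LongRange.shell G X l).card ≤ (LongRange.shell G X ((r / 2 : ℕ) : ℤ)).card)
    (W : LongRange.Op V) (hWX : LongRange.ActsOn X W) (hW : LongRange.opNorm W = 1)
    (t : ℝ) (ht : |t| ≤ 1 / (2 * Real.exp 1 * LongRange.gTilde g lam J₀ k)) :
    LongRange.frobNorm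
        (LongRange.evolve (LongRange.hamiltonian c) t W
          - LongRange.localApprox (LongRange.nbhd G X r)
              (LongRange.evolve (LongRange.hamiltonian c) t W))
      ≤ LongRange.constC α J₀ γ (LongRange.gTilde g lam J₀ k) D * |t|
          * Real.sqrt (γ⁻¹ * ((LongRange.shell G X ((r / 2 : ℕ) : ℤ)).card : ℝ)
              * (r : ℝ) ^ (-2 * α + D + 1)) := by
  refine (theorem3_general G hG D hD γ hlat α (LongRange.add_one_lt_two_mul hD hα) c J₀ hdecay lam
    hlam X r hr hreg W hWX t).trans ?_
  rw [hW, mul_one]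
  gcongr
  exact LongRange.rpow_mul_exp_le_constC hD hα (zero_le_one.trans hγ) hJ₀.le
    (hlam.nonneg hG.nonempty.some) ht
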